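/- **Conventions.** Let $\mathcal{A}$ be an abelian category. Let $\mathbf{F}\mathcal{A}$ be the additive category of objects $A$ of $\mathcal{A}$ with a finite decreasing filtration $(F^pA)_{p\in\mathbb{Z}}$ (so $F^pA=A$ for some $p$ and $F^qA=0$ for some $q$), the morphisms being the morphisms of $\mathcal{A}$ compatible with the filtrations. Let $\mathbf{C}^+(\mathbf{F}\mathcal{A})$ be the category of bounded below cochain complexes over $\mathbf{F}\mathcal{A}$. Fix an integer $r\ge 0$. * The page $E_r(K)$ of the spectral sequence of $K\in \mathbf{C}^+(\mathbf{F}\mathcal{A})$ has terms $E_r^{p,n-p}(K)=Z_r^p/(Z_r^p\cap B_r^p)$, where $Z_r^p=F^pK^n\cap d^{-1}(F^{p+r}K^{n+1})$ and $B_r^p=F^{p+1}K^n+d(F^{p-r+1}K^{n-1})$, and the differential $d_r$ induced by $d$. An *$E_r$-quasi-isomorphism* is a morphism $f$ such that $E_r(f)$ is a quasi-isomorphism of complexes; $\mathcal{E}_r$ is the class of these, and $\mathbf{D}_r^+(\mathbf{F}\mathcal{A}):=\mathbf{C}^+(\mathbf{F}\mathcal{A})[\mathcal{E}_r^{-1}]$.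 * An *$r$-homotopy* from $f$ to $g$, for $f,g:K\to L$, is a family of morphisms $h^n:K^{n+1}\to L^n$ with $h^n(F^{p+r}K^{n+1})\subset F^{p}L^n$ for all $p$ and $n$, such that $dh+hd=g-f$. $\mathcal{S}_r$ is the class of $r$-homotopy equivalences, i.e. of the morphisms that have an inverse up to $r$-homotopy. * $K$ is *$r$-injective* if for all $p$ one has $d(F^pK)\subset F^{p+r}K$ and $Gr_F^pK$ is a complex of injective objects of $\mathcal{A}$. $\mathbf{C}_r^+(\mathbf{F}\mathrm{Inj}\,\mathcal{A})$ is the full subcategory of $\mathbf{C}^+(\mathbf{F}\mathcal{A})$ of $r$-injective complexes, and $\mathbf{K}_r^+(\mathbf{F}\mathrm{Inj}\,\mathcal{A})$ is its quotient by the relation of $r$-homotopy. * Let $\mathcal{C}$ be a category and $\mathcal{S}\subset\mathcal{W}$ two classes of morphisms (strong and weak equivalences), both containing the isomorphisms and closed under composition. An object $M$ is *fibrant* if every $w:Y\to X$ in $\mathcal{W}$ induces a bijection $\mathcal{C}[\mathcal{S}^{-1}](X,M)\to\mathcal{C}[\mathcal{S}^{-1}](Y,M)$. A *fibrant model* of $X$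 is a morphism $X\to M$ of $\mathcal{C}[\mathcal{S}^{-1}]$ with $M$ fibrant that becomes an isomorphism in $\mathcal{C}[\mathcal{W}^{-1}]$. The triple $(\mathcal{C},\mathcal{S},\mathcal{W})$ is a *right Cartan–Eilenberg category with fibrant models in $\mathcal{M}$* if all objects of the full subcategory $\mathcal{M}$ are fibrant and every object of $\mathcal{C}$ has a fibrant model $X\to M$ with $M\in\mathcal{M}$. **Theorem.** Let $\mathcal{A}$ be an abelian category with enough injectives and let $r\geq 0$. Then: 1. $(\mathbf{C}^+(\mathbf{F}\mathcal{A}),\mathcal{S}_r,\mathcal{E}_r)$ is a right Cartan–Eilenberg category with fibrant models in $\mathbf{C}_r^+(\mathbf{F}\mathrm{Inj}\,\mathcal{A})$. Moreover, every $K\in\mathbf{C}^+(\mathbf{F}\mathcal{A})$ admits an $E_r$-quasi-isomorphism $\rho:K\to I$, a morphism of $\mathbf{C}^+(\mathbf{F}\mathcal{A})$, to an $r$-injective complex $I$. 2. The inclusion $\mathbf{C}_r^+(\mathbf{F}\mathrm{Inj}\,\mathcal{A})\subset\mathbf{C}^+(\mathbf{F}\mathcal{A})$ induces an equivalence of categories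 $$\mathbf{K}_r^+(\mathbf{F}\mathrm{Inj}\,\mathcal{A})\stackrel{\sim}{\longrightarrow}\mathbf{D}_r^+(\mathbf{F}\mathcal{A}).$$ -/

import Mathlib

open CategoryTheory CategoryTheory.Limits

universe v u

noncomputable section

/-! ### Filtered objects -/

/-- An object of `A` with a finite decreasing filtration indexed by the integers. -/
structure FilteredObject (A : Type u) [Category.{v} A] [Abelian A] where
  /-- the underlying object -/
  obj : A
  /-- the steps of the filtration -/
  F : ℤ → Subobject obj
  antitone : Antitone F
  exists_eq_top : ∃ p, F p = ⊤
  exists_eq_bot : ∃ q, F q = ⊥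

namespace FilteredObject

variable {A : Type u} [Category.{v} A] [Abelian A]

/-- A morphism of filtered objects: a morphism `f` with `f (F p) ⊆ F p` for all `p`. -/
@[ext]
structure Hom (X Y : FilteredObject A) where
  /-- the underlying morphism -/
  hom : X.obj ⟶ Y.obj
  factors : ∀ p, (Y.F p).Factors ((X.F p).arrow ≫ hom)

/-- If `f` maps `P` into `Q` and `g` maps `Q` into `R`, then `f ≫ g` maps `P` into `R`. -/
lemma factors_comp {X Y Z : A} {P : Subobject X} {Q : Subobject Y} {R : Subobject Z}
    {f : X ⟶ Y} {g : Y ⟶ Z} (hf : Q.Factors (P.arrow ≫ f)) (hg : R.Factors (Q.arrow ≫ g)) :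
    R.Factors (P.arrow ≫ f ≫ g) := by
  rw [← Category.assoc, ← Q.factorThru_arrow _ hf, Category.assoc]
  exact Subobject.factors_of_factors_right _ hg

lemma factors_neg {X Y : A} {P : Subobject Y} {f : X ⟶ Y} (h : P.Factors f) :
    P.Factors (-f) := by
  rw [← P.factorThru_arrow _ h, ← Preadditive.neg_comp]
  exact Subobject.factors_comp_arrow _

instance : Category (FilteredObject A) where
  Hom := Hom
  id X := ⟨𝟙 _, fun p => by simpa using Subobject.factors_self _⟩
  comp f g := ⟨f.hom ≫ g.hom, fun p => factors_comp (f.factors p) (g.factors p)⟩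
  id_comp _ := Hom.ext (Category.id_comp _)
  comp_id _ := Hom.ext (Category.comp_id _)
  assoc _ _ _ := Hom.ext (Category.assoc _ _ _)

@[ext]
lemma hom_ext {X Y : FilteredObject A} {f g : X ⟶ Y} (h : f.hom = g.hom) : f = g :=
  Hom.ext h

@[simp] lemma id_hom (X : FilteredObject A) : (𝟙 X : X ⟶ X).hom = 𝟙 X.obj := rfl

@[simp] lemma comp_hom {X Y Z : FilteredObject A} (f : X ⟶ Y) (g : Y ⟶ Z) :
    (f ≫ g).hom = f.hom ≫ g.hom := rfl

variable (X Y : FilteredObject A)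

instance : Zero (X ⟶ Y) := ⟨⟨0, fun p => by simpa using Subobject.factors_zero⟩⟩

instance : Add (X ⟶ Y) :=
  ⟨fun f g => ⟨f.hom + g.hom, fun p => by
    rw [Preadditive.comp_add]
    exact Subobject.factors_add _ _ (f.factors p) (g.factors p)⟩⟩

instance : Neg (X ⟶ Y) :=
  ⟨fun f => ⟨-f.hom, fun p => by
    rw [Preadditive.comp_neg]
    exact factors_neg (f.factors p)⟩⟩

@[simp] lemma zero_hom : (0 : X ⟶ Y).hom = 0 := rfl

variable {X Y}

@[simp] lemma add_hom (f g : X ⟶ Y) : (f + g).hom = f.hom + g.hom := rfl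

@[simp] lemma neg_hom (f : X ⟶ Y) : (-f).hom = -f.hom := rfl

instance : AddCommGroup (X ⟶ Y) where
  add_assoc _ _ _ := hom_ext (add_assoc _ _ _)
  zero_add _ := hom_ext (zero_add _)
  add_zero _ := hom_ext (add_zero _)
  nsmul := nsmulRec
  zsmul := zsmulRec
  neg_add_cancel _ := hom_ext (neg_add_cancel _)
  add_comm _ _ := hom_ext (add_comm _ _)

instance : Preadditive (FilteredObject A) where
  add_comp _ _ _ _ _ _ := hom_ext (Preadditive.add_comp _ _ _ _ _ _)
  comp_add _ _ _ _ _ _ := hom_ext (Preadditive.comp_add _ _ _ _ _ _)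

/-- The graded piece `Gr^p X = F^p X / F^{p+1} X`. -/
def gr (p : ℤ) (X : FilteredObject A) : A :=
  cokernel ((X.F (p + 1)).ofLE (X.F p) (X.antitone (by lia)))

/-- The automorphism `α_r` of the category of filtered objects: it replaces `F` by `F(r)`, where
`F(r)^p = F^{p+r}`, and is the identity on morphisms. -/
@[simps]
def shiftFiltration (r : ℤ) : FilteredObject A ⥤ FilteredObject A where
  obj X :=
    { obj := X.obj
      F := fun p => X.F (p + r)
      antitone := fun _ _ h => X.antitone (by lia)
      exists_eq_top := X.exists_eq_top.imp' (fun p => p - r) (fun p h => by simpa using h)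
      exists_eq_bot := X.exists_eq_bot.imp' (fun p => p - r) (fun p h => by simpa using h) }
  map f := ⟨f.hom, fun p => f.factors (p + r)⟩

/-- The natural transformation `α_r ⟶ 1` given by the identity of the underlying objects
(for `r ≥ 0`). -/
@[simps]
def shiftFiltrationToId (r : ℕ) : shiftFiltration (A := A) r ⟶ 𝟭 (FilteredObject A) where
  app X := ⟨𝟙 X.obj, fun p => by
    change (X.F p).Factors ((X.F (p + r)).arrow ≫ 𝟙 X.obj)
    rw [Category.comp_id]
    exact Subobject.factors_of_le _ (X.antitone (by lia)) (Subobject.factors_self _)⟩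
  naturality _ _ _ := hom_ext ((Category.comp_id _).trans (Category.id_comp _).symm)

end FilteredObject

/-! ### The spectral sequence of a filtered complex -/

namespace FilteredComplex

open FilteredObject

variable {A : Type u} [Category.{v} A] [Abelian A]

/-- `Z_r^p = ker (F^p K^n ⟶ K^{n+1} / F^{p+r} K^{n+1})`, that is `F^p ∩ d⁻¹ (F^{p+r})`,
as a subobject of `K^n`. -/
def Z (K : CochainComplex (FilteredObject A) ℤ) (r p n : ℤ) : Subobject (K.X n).obj :=
  (K.X n).F p ⊓ (Subobject.pullback (K.d n (n + 1)).hom).obj ((K.X (n + 1)).F (p + r))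

/-- `B_r^p = F^{p+1} K^n + d (F^{p-r+1} K^{n-1})`, as a subobject of `K^n`. -/
def B (K : CochainComplex (FilteredObject A) ℤ) (r p n : ℤ) : Subobject (K.X n).obj :=
  (K.X n).F (p + 1) ⊔
    imageSubobject (((K.X (n - 1)).F (p - r + 1)).arrow ≫ (K.d (n - 1) n).hom)

section

variable {X Y : A}

lemma factors_pullback_iff {W : A} (f : X ⟶ Y) (Q : Subobject Y) (g : W ⟶ X) :
    ((Subobject.pullback f).obj Q).Factors g ↔ Q.Factors (g ≫ f) := by
  constructor
  · intro h
    rw [← Subobject.factorThru_arrow _ g h, Category.assoc, ← (Subobject.isPullback f Q).w,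
      ← Category.assoc]
    exact Subobject.factors_comp_arrow _
  · intro h
    have := (Subobject.isPullback f Q).lift_snd (Q.factorThru _ h) g (by simp)
    rw [← this]
    exact Subobject.factors_comp_arrow _

lemma factors_iff_le_pullback (f : X ⟶ Y) (P : Subobject X) (Q : Subobject Y) :
    Q.Factors (P.arrow ≫ f) ↔ P ≤ (Subobject.pullback f).obj Q := by
  rw [← factors_pullback_iff]
  exact ⟨Subobject.le_of_factors, fun h => Subobject.factors_of_le _ h P.factors_self⟩

lemma imageSubobject_le_iff (f : X ⟶ Y) (Q : Subobject Y) :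
    imageSubobject f ≤ Q ↔ Q.Factors f := by
  constructor
  · intro h
    exact Subobject.factors_of_le _ h
      (by simpa using Subobject.factors_comp_arrow (factorThruImageSubobject f))
  · intro h
    exact imageSubobject_le f (Q.factorThru f h) (by simp)

lemma factors_sup_arrow (f : X ⟶ Y) {P P' : Subobject X} {Q : Subobject Y}
    (h : Q.Factors (P.arrow ≫ f)) (h' : Q.Factors (P'.arrow ≫ f)) :
    Q.Factors ((P ⊔ P').arrow ≫ f) := by
  rw [factors_iff_le_pullback] at *
  exact sup_le h h'

lemma factors_imageSubobject_arrow {W : A} (f : X ⟶ Y) (g : W ⟶ X) {Q : Subobject Y}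
    (h : Q.Factors (g ≫ f)) : Q.Factors ((imageSubobject g).arrow ≫ f) := by
  rw [factors_iff_le_pullback, imageSubobject_le_iff, factors_pullback_iff]
  exact h

lemma factors_inf_arrow (f : X ⟶ Y) {P P' : Subobject X} {Q : Subobject Y}
    (h : Q.Factors (P.arrow ≫ f)) : Q.Factors ((P ⊓ P').arrow ≫ f) := by
  rw [factors_iff_le_pullback] at *
  exact inf_le_left.trans h

lemma factors_inf_arrow' (f : X ⟶ Y) {P P' : Subobject X} {Q : Subobject Y}
    (h : Q.Factors (P'.arrow ≫ f)) : Q.Factors ((P ⊓ P').arrow ≫ f) := by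
  rw [factors_iff_le_pullback] at *
  exact inf_le_right.trans h

/-- The subquotient `S / (S ∩ T)` of `X`. -/
abbrev subquotient (S T : Subobject X) : A := cokernel ((S ⊓ T).ofLE S inf_le_left)

/-- A morphism `f` which maps `S` into `S'` and `S ∩ T` into `T'` induces a morphism from
`S / (S ∩ T)` to `S' / (S' ∩ T')`. -/
def subquotientMap (f : X ⟶ Y) {S T : Subobject X} {S' T' : Subobject Y}
    (hS : S'.Factors (S.arrow ≫ f)) (hT : T'.Factors ((S ⊓ T).arrow ≫ f)) :
    subquotient S T ⟶ subquotient S' T' :=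
  cokernel.map _ _
    ((S' ⊓ T').factorThru ((S ⊓ T).arrow ≫ f)
      ((Subobject.inf_factors _).2 ⟨factors_inf_arrow f hS, hT⟩))
    (S'.factorThru (S.arrow ≫ f) hS)
    ((cancel_mono S'.arrow).1 (by simp))

lemma subquotientMap_id {S T : Subobject X} (hS : S.Factors (S.arrow ≫ 𝟙 X))
    (hT : T.Factors ((S ⊓ T).arrow ≫ 𝟙 X)) : subquotientMap (𝟙 X) hS hT = 𝟙 _ := by
  apply coequalizer.hom_ext
  simp [subquotientMap]

lemma subquotientMap_comp {W : A} (f : X ⟶ Y) (g : Y ⟶ W) {S T : Subobject X}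
    {S' T' : Subobject Y} {S'' T'' : Subobject W}
    (hS : S'.Factors (S.arrow ≫ f)) (hT : T'.Factors ((S ⊓ T).arrow ≫ f))
    (hS' : S''.Factors (S'.arrow ≫ g)) (hT' : T''.Factors ((S' ⊓ T').arrow ≫ g))
    (e : X ⟶ W) (he : f ≫ g = e) (hSe : S''.Factors (S.arrow ≫ e))
    (hTe : T''.Factors ((S ⊓ T).arrow ≫ e)) :
    subquotientMap f hS hT ≫ subquotientMap g hS' hT' = subquotientMap e hSe hTe := by
  subst he
  apply coequalizer.hom_ext
  have : S'.factorThru (S.arrow ≫ f) hS ≫ S''.factorThru (S'.arrow ≫ g) hS' =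
      S''.factorThru (S.arrow ≫ f ≫ g) hSe := (cancel_mono S''.arrow).1 (by simp)
  simp [subquotientMap, reassoc_of% this]

lemma subquotientMap_zero {S T : Subobject X} {S' T' : Subobject Y}
    (hS : S'.Factors (S.arrow ≫ (0 : X ⟶ Y))) (hT : T'.Factors ((S ⊓ T).arrow ≫ (0 : X ⟶ Y))) :
    subquotientMap (0 : X ⟶ Y) hS hT = 0 := by
  apply coequalizer.hom_ext
  simp [subquotientMap]

end

/-- The term `E_r` of filtration degree `p` and total degree `n`: the quotient of `Z_r^p` by
`Z_r^p ∩ B_r^p`. In the usual bigraded notation this is `E_r^{p,n-p}`. -/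
abbrev E (K : CochainComplex (FilteredObject A) ℤ) (r p n : ℤ) : A :=
  subquotient (Z K r p n) (B K r p n)

variable {K L : CochainComplex (FilteredObject A) ℤ}

lemma d_hom_comp_d_hom (i j k : ℤ) : (K.d i j).hom ≫ (K.d j k).hom = 0 :=
  congr_arg Hom.hom (K.d_comp_d i j k)

lemma hom_comm (f : K ⟶ L) (i j : ℤ) :
    (f.f i).hom ≫ (L.d i j).hom = (K.d i j).hom ≫ (f.f j).hom :=
  congr_arg Hom.hom (f.comm i j)

/-- `f (Z_r^p K) ⊆ Z_r^p L`. -/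
lemma factors_Z_f (f : K ⟶ L) (r p n : ℤ) :
    (Z L r p n).Factors ((Z K r p n).arrow ≫ (f.f n).hom) := by
  refine (Subobject.inf_factors _).2 ?_
  rw [factors_pullback_iff, Category.assoc, hom_comm]
  exact ⟨factors_inf_arrow _ ((f.f n).factors p),
    factors_comp ((factors_iff_le_pullback _ _ _).2 inf_le_right) ((f.f _).factors _)⟩

/-- `f (B_r^p K) ⊆ B_r^p L`. -/
lemma factors_B_f (f : K ⟶ L) (r p n : ℤ) :
    (B L r p n).Factors ((B K r p n).arrow ≫ (f.f n).hom) := by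
  refine factors_sup_arrow _ (Subobject.sup_factors_of_factors_left ((f.f n).factors _))
    (Subobject.sup_factors_of_factors_right (factors_imageSubobject_arrow _ _ ?_))
  rw [Category.assoc, ← hom_comm, ← Category.assoc,
    ← Subobject.factorThru_arrow _ _ ((f.f (n - 1)).factors (p - r + 1)), Category.assoc]
  exact Subobject.factors_of_factors_right _ ((imageSubobject_le_iff _ _).1 le_rfl)

/-- `d (Z_r^p) ⊆ Z_r^{p+r}`. -/
lemma factors_Z_d (K : CochainComplex (FilteredObject A) ℤ) {r p n p' n' : ℤ}
    (hp : p + r = p') (hn : n + 1 = n') :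
    (Z K r p' n').Factors ((Z K r p n).arrow ≫ (K.d n n').hom) := by
  subst hp hn
  refine (Subobject.inf_factors _).2 ?_
  rw [factors_pullback_iff, Category.assoc, d_hom_comp_d_hom, comp_zero]
  exact ⟨(factors_iff_le_pullback _ _ _).2 inf_le_right, Subobject.factors_zero⟩

/-- `d (B_r^p) ⊆ B_r^{p+r}`. -/
lemma factors_B_d (K : CochainComplex (FilteredObject A) ℤ) {r p n p' n' : ℤ}
    (hp : p + r = p') (hn : n + 1 = n') :
    (B K r p' n').Factors ((B K r p n).arrow ≫ (K.d n n').hom) := by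
  obtain rfl : n = n' - 1 := by lia
  obtain rfl : p = p' - r := by lia
  refine factors_sup_arrow _ (Subobject.sup_factors_of_factors_right
    ((imageSubobject_le_iff _ _).1 le_rfl)) (factors_imageSubobject_arrow _ _ ?_)
  rw [Category.assoc, d_hom_comp_d_hom, comp_zero]
  exact Subobject.factors_zero

open Classical in
/-- The differential `d_r`, induced by the differential of `K`, from `E_r` in filtration degree `p`
and total degree `n` to `E_r` in filtration degree `p + r` and total degree `n + 1`
(and zero between other degrees). -/
def E.d (K : CochainComplex (FilteredObject A) ℤ) (r p n p' n' : ℤ) : E K r p n ⟶ E K r p' n' :=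
  if h : p + r = p' ∧ n + 1 = n' then
    subquotientMap (K.d n n').hom (factors_Z_d K h.1 h.2)
      (factors_inf_arrow' _ (factors_B_d K h.1 h.2))
  else 0

lemma E.d_eq {r p n p' n' : ℤ} (hp : p + r = p') (hn : n + 1 = n') :
    E.d K r p n p' n' = subquotientMap (K.d n n').hom (factors_Z_d K hp hn)
      (factors_inf_arrow' _ (factors_B_d K hp hn)) :=
  dif_pos ⟨hp, hn⟩

/-- The morphism `E_r(f)` in filtration degree `p` and total degree `n`. -/
def E.map (f : K ⟶ L) (r p n : ℤ) : E K r p n ⟶ E L r p n :=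
  subquotientMap (f.f n).hom (factors_Z_f f r p n)
    (factors_inf_arrow' _ (factors_B_f f r p n))

lemma E.map_id (K : CochainComplex (FilteredObject A) ℤ) (r p n : ℤ) :
    E.map (𝟙 K) r p n = 𝟙 (E K r p n) :=
  subquotientMap_id (factors_Z_f (𝟙 K) r p n) (factors_inf_arrow' _ (factors_B_f (𝟙 K) r p n))

lemma E.map_comp {M : CochainComplex (FilteredObject A) ℤ} (f : K ⟶ L) (g : L ⟶ M)
    (r p n : ℤ) : E.map (f ≫ g) r p n = E.map f r p n ≫ E.map g r p n :=
  (subquotientMap_comp _ _ _ _ _ _ _ rfl (factors_Z_f (f ≫ g) r p n)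
    (factors_inf_arrow' _ (factors_B_f (f ≫ g) r p n))).symm

/-- The page `E_r(K)` of the spectral sequence of a filtered complex, as a complex with
differential `d_r`. The indices are pairs `(p, n)` (filtration degree, total degree) and the
differential has degree `(r, 1)`; in the bigrading `(p, q)` with `q = n - p` this is
the usual degree `(r, 1 - r)`. -/
def page (r : ℕ) :
    CochainComplex (FilteredObject A) ℤ ⥤
      HomologicalComplex A (ComplexShape.up' ((r : ℤ), (1 : ℤ))) where
  obj K :=
    { X := fun i => E K r i.1 i.2
      d := fun i j => E.d K r i.1 i.2 j.1 j.2
      shape := fun i j hij => dif_neg fun h => hij (Prod.ext h.1 h.2)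
      d_comp_d' := by
        rintro ⟨p, n⟩ ⟨p', n'⟩ ⟨p'', n''⟩ h h'
        have h1 : p + r = p' ∧ n + 1 = n' := Prod.ext_iff.1 h
        have h2 : p' + r = p'' ∧ n' + 1 = n'' := Prod.ext_iff.1 h'
        dsimp only
        rw [E.d_eq h1.1 h1.2, E.d_eq h2.1 h2.2]
        refine (subquotientMap_comp _ _ _ _ _ _ 0 (d_hom_comp_d_hom _ _ _) ?_ ?_).trans
          (subquotientMap_zero _ _)
        all_goals rw [comp_zero]; exact Subobject.factors_zero }
  map {K L} f :=
    { f := fun i => E.map f r i.1 i.2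
      comm' := by
        rintro ⟨p, n⟩ ⟨p', n'⟩ h
        have h1 : p + r = p' ∧ n + 1 = n' := Prod.ext_iff.1 h
        have hS : (Z L r p' n').Factors ((Z K r p n).arrow ≫ (K.d n n').hom ≫ (f.f n').hom) :=
          factors_comp (factors_Z_d K h1.1 h1.2) (factors_Z_f f r p' n')
        have hT : (B L r p' n').Factors
            ((Z K r p n ⊓ B K r p n).arrow ≫ (K.d n n').hom ≫ (f.f n').hom) :=
          factors_inf_arrow' _
            (factors_comp (factors_B_d K h1.1 h1.2) (factors_B_f f r p' n'))
        dsimp only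
        rw [E.d_eq h1.1 h1.2, E.d_eq h1.1 h1.2]
        exact (subquotientMap_comp _ _ _ _ _ _ _ (hom_comm f n n') hS hT).trans
          (subquotientMap_comp _ _ _ _ _ _ _ rfl hS hT).symm }
  map_id K := HomologicalComplex.hom_ext _ _ fun i => E.map_id K r i.1 i.2
  map_comp f g := HomologicalComplex.hom_ext _ _ fun i => E.map_comp f g r i.1 i.2

/-! ### Homotopies, weak equivalences and injective complexes -/

/-- An `r`-homotopy from `f` to `g`: a degree preserving filtered map `h : T_r(K) ⟶ L`, where
`T_r(K)^n` is `K^{n+1}` with the filtration `F(r)`, such that `d h + h d = g - f`.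
(The equation is required in all degrees; these are written `n + 1` with `n` an integer.) -/
structure RHomotopy (r : ℕ) (f g : K ⟶ L) where
  /-- the components of the homotopy -/
  h : ∀ n : ℤ, (shiftFiltration (r : ℤ)).obj (K.X (n + 1)) ⟶ L.X n
  comm : ∀ n : ℤ,
    h n ≫ L.d n (n + 1) + (shiftFiltration (r : ℤ)).map (K.d (n + 1) (n + 1 + 1)) ≫ h (n + 1) =
      (shiftFiltrationToId r).app (K.X (n + 1)) ≫ (g.f (n + 1) - f.f (n + 1))

variable (A) in
/-- The class `S_r` of `r`-homotopy equivalences between bounded below filtered complexes. -/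
def rHomotopyEquivalences (r : ℕ) : MorphismProperty (CochainComplex.Plus (FilteredObject A)) :=
  fun K L f => ∃ g : L ⟶ K,
    Nonempty (RHomotopy r (f ≫ g).hom (𝟙 K : K ⟶ K).hom) ∧
      Nonempty (RHomotopy r (g ≫ f).hom (𝟙 L : L ⟶ L).hom)

variable (A) in
/-- The class `E_r` of `E_r`-quasi-isomorphisms between bounded below filtered complexes: the
morphisms which induce a quasi-isomorphism of complexes between the pages `E_r`. -/
def rQuasiIsomorphisms (r : ℕ) : MorphismProperty (CochainComplex.Plus (FilteredObject A)) :=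
  fun _ _ f => QuasiIso ((page r).map f.hom)

variable (A) in
/-- The bounded below filtered complexes `K` which are `r`-injective: `d (F^p K) ⊆ F^{p+r} K` and
`Gr^p K` is a complex of injective objects, for all `p`. -/
def rInjective (r : ℕ) : ObjectProperty (CochainComplex.Plus (FilteredObject A)) :=
  fun K =>
    (∀ p n : ℤ, ((K.obj.X (n + 1)).F (p + r)).Factors
      (((K.obj.X n).F p).arrow ≫ (K.obj.d n (n + 1)).hom)) ∧
    ∀ p n : ℤ, Injective ((K.obj.X n).gr p)

variable (A) in
/-- The relation of `r`-homotopy between morphisms of `r`-injective complexes. -/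
def rInjectiveHomotopic (r : ℕ) : HomRel (rInjective A r).FullSubcategory :=
  fun _ _ f g => Nonempty (RHomotopy r f.hom.hom g.hom.hom)

variable (A) in
/-- The category `K_r^+(F Inj A)` of `r`-injective complexes modulo `r`-homotopy. -/
abbrev RInjectiveHomotopyCategory (r : ℕ) := Quotient (rInjectiveHomotopic A r)

variable (A) in
/-- The `r`-derived category `D_r^+(F A)`: the localization of the category of bounded below
filtered complexes with respect to `E_r`-quasi-isomorphisms. -/
abbrev RDerivedCategory (r : ℕ) := (rQuasiIsomorphisms A r).Localization

end FilteredComplex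

/-! ### Cartan-Eilenberg categories -/

namespace CartanEilenberg

variable {C : Type*} [Category* C] (S W : MorphismProperty C)

/-- `(C, S, W)` is a category with strong equivalences `S` and weak equivalences `W`: both classes
contain the isomorphisms and are closed under composition, and `S ⊆ W`. -/
structure IsCategoryWithStrongAndWeakEquivalences : Prop where
  isomorphisms_le_strong : MorphismProperty.isomorphisms C ≤ S
  isomorphisms_le_weak : MorphismProperty.isomorphisms C ≤ W
  strong_comp : S.IsStableUnderComposition
  weak_comp : W.IsStableUnderComposition
  strong_le_weak : S ≤ W

/-- An object `M` is fibrant if every weak equivalence `w : Y ⟶ X` induces a bijection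
`C[S⁻¹](X, M) ⟶ C[S⁻¹](Y, M)`. -/
def IsFibrant (M : C) : Prop :=
  ∀ ⦃X Y : C⦄ (w : Y ⟶ X), W w →
    Function.Bijective (fun g : S.Q.obj X ⟶ S.Q.obj M => S.Q.map w ≫ g)

variable {S W} in
/-- The canonical functor `C[S⁻¹] ⥤ C[W⁻¹]`. -/
def toWeakLocalization (h : IsCategoryWithStrongAndWeakEquivalences S W) :
    S.Localization ⥤ W.Localization :=
  Localization.Construction.lift W.Q fun _ _ f hf => W.Q_inverts f (h.strong_le_weak f hf)

/-- `(C, S, W)` is a right Cartan-Eilenberg category with fibrant models in the class `P`: it is a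
category with strong and weak equivalences, the objects in `P` are fibrant, and every object `X`
has a fibrant model in `P`, i.e. there are an object `M` in `P` and a morphism `X ⟶ M` of `C[S⁻¹]`
which becomes an isomorphism in `C[W⁻¹]`. -/
structure IsRightCartanEilenbergWithModels (P : ObjectProperty C) : Prop where
  toStrongWeak : IsCategoryWithStrongAndWeakEquivalences S W
  isFibrant : ∀ M, P M → IsFibrant S W M
  exists_model : ∀ X : C, ∃ M : C, P M ∧
    ∃ ε : S.Q.obj X ⟶ S.Q.obj M, IsIso ((toWeakLocalization toStrongWeak).map ε)

end CartanEilenberg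

end

/-!
Every object `X` of an abelian category has an abelian group `El X` of elements, provided by the
Freyd-Mitchell embedding. Since the embedding is exact and faithful, the statements about filtered
complexes can be proved by computations with elements. The proof rests on four facts.

* `FilteredComplex.page_quasiIso_iff`: a morphism is an `E_r`-quasi-isomorphism if and only if it
  is bijective on the page `E_{r+1}`. It follows that `r`-homotopy equivalences are
  `E_r`-quasi-isomorphisms, and that the `r`-cone of an `E_r`-quasi-isomorphism, in which the
  filtration of the source is shifted by `r`, is `r`-acyclic (`FilteredComplex.rAcyclic_cone`).
* `FilteredComplex.RAcyclic.exists_rHomotopy`: morphisms from a bounded below `r`-acyclic complex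
  to an `r`-injective complex are `r`-homotopic to zero. The homotopy is built degree by degree,
  because morphisms to a filtered object with injective graded pieces extend as soon as this is
  compatible with the filtrations (`FilteredObject.exists_filtered_extension`). Applied to
  cones, it shows that an `E_r`-quasi-isomorphism induces a bijection between `r`-homotopy classes
  of morphisms to an `r`-injective complex (`FilteredComplex.isLocalUpTo_rQuasiIsomorphisms`).
* `FilteredComplex.exists_rInjective_resolution`: every bounded below complex `K` has an
  `E_r`-quasi-isomorphism to an `r`-injective complex `I`. In each degree, the quotient of
  `I^n ⊕ K^{n+1}`, with `K^{n+1}` filtered by `F(r)`, by the boundaries of the cone is strictly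
  embedded into a filtered injective object, whose filtration is then shifted by `-r`.
* `FilteredComplex.map_eq_of_rHomotopic`: a functor which inverts the `r`-homotopy equivalences
  identifies `r`-homotopic morphisms, as these factor through two sections of the projection
  `K ⊕ C ⟶ K`, where `C` is the `r`-cone of the identity of `K`, which is `r`-contractible.

Let `V` be a class of morphisms such that homotopic morphisms become equal in `C[V⁻¹]`, and let `M`
be an object such that `V` induces bijections between homotopy classes of morphisms to `M`.
Then the morphisms to `M` in `C[V⁻¹]` are the homotopy classes of morphisms of `C`
(`CartanEilenberg.IsLocalUpTo.exists_map_eq` and `CartanEilenberg.IsLocalUpTo.rel_of_map_eq`).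
For the `r`-homotopy equivalences, every `M` has this property. For the `E_r`-quasi-isomorphisms,
the `r`-injective complexes have it: hence they are fibrant, and the functor from their homotopy
category to the derived category is fully faithful. It is essentially surjective because
resolutions exist.
-/

noncomputable section

/-! ### Elements of objects of an abelian category -/

namespace AbelianElement

variable {A : Type u} [Category.{v} A] [Abelian A]

/-- The elements of an object of an abelian category: those of its image under the
Freyd-Mitchell embedding. As the embedding is faithful and exact, equalities of morphisms,
inclusions of subobjects and exactness can be checked on these elements. -/
abbrev El (X : A) : Type (max u v) := (Abelian.FreydMitchell.functor A).obj X

/-- The action of a morphism on elements. -/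
def ev {X Y : A} (f : X ⟶ Y) : El X →+ El Y :=
  ((Abelian.FreydMitchell.functor A).map f).hom.toAddMonoidHom

variable {X Y Z : A}

@[simp] lemma ev_id (x : El X) : ev (𝟙 X) x = x := by
  simp [ev]

@[simp] lemma ev_comp (f : X ⟶ Y) (g : Y ⟶ Z) (x : El X) : ev (f ≫ g) x = ev g (ev f x) := by
  simp [ev]

instance : (Abelian.FreydMitchell.functor A).Additive :=
  Functor.additive_of_preserves_binary_products _

@[simp] lemma ev_zero (x : El X) : ev (0 : X ⟶ Y) x = 0 := by
  simp [ev]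

@[simp] lemma ev_add (f g : X ⟶ Y) (x : El X) : ev (f + g) x = ev f x + ev g x := by
  simp [ev, Functor.map_add]

@[simp] lemma ev_neg (f : X ⟶ Y) (x : El X) : ev (-f) x = -ev f x := by
  simp [ev, Functor.map_neg]

@[simp] lemma ev_sub (f g : X ⟶ Y) (x : El X) : ev (f - g) x = ev f x - ev g x := by
  simp [ev, Functor.map_sub]

lemma ev_sum {ι : Type*} (s : Finset ι) (f : ι → (X ⟶ Y)) (x : El X) :
    ev (∑ i ∈ s, f i) x = ∑ i ∈ s, ev (f i) x := by
  classical
  induction s using Finset.induction_on with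
  | empty => simp
  | insert a s ha ih => simp [Finset.sum_insert ha, ih]

lemma hom_ext_ev {f g : X ⟶ Y} (h : ∀ x, ev f x = ev g x) : f = g := by
  apply (Abelian.FreydMitchell.functor A).map_injective
  ext x
  exact h x

lemma ev_injective_iff (f : X ⟶ Y) : Function.Injective (ev f) ↔ Mono f := by
  rw [← (Abelian.FreydMitchell.functor A).mono_map_iff_mono, ModuleCat.mono_iff_injective]
  rfl

lemma ev_surjective_iff (f : X ⟶ Y) : Function.Surjective (ev f) ↔ Epi f := by
  rw [← (Abelian.FreydMitchell.functor A).epi_map_iff_epi, ModuleCat.epi_iff_surjective]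
  rfl

lemma ev_injective (f : X ⟶ Y) [Mono f] : Function.Injective (ev f) :=
  (ev_injective_iff f).2 inferInstance

lemma ev_surjective (f : X ⟶ Y) [Epi f] : Function.Surjective (ev f) :=
  (ev_surjective_iff f).2 inferInstance

lemma exists_of_exact {S : ShortComplex A} (hS : S.Exact) (x : El S.X₂) (hx : ev S.g x = 0) :
    ∃ y, ev S.f y = x :=
  ((ShortComplex.moduleCat_exact_iff _).1
    (hS.map (Abelian.FreydMitchell.functor A))) x hx

/-- The elements of `X` which belong to the subobject `P`. -/
def elements (P : Subobject X) : AddSubgroup (El X) := (ev P.arrow).range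

@[simp] lemma ev_arrow_mem (P : Subobject X) (s : El (P : A)) : ev P.arrow s ∈ elements P :=
  ⟨s, rfl⟩

lemma factors_iff {W : A} (P : Subobject X) (f : W ⟶ X) :
    P.Factors f ↔ ∀ w, ev f w ∈ elements P := by
  constructor
  · intro h w
    rw [← P.factorThru_arrow f h, ev_comp]
    exact ev_arrow_mem _ _
  · intro h
    have h0 : f ≫ cokernel.π P.arrow = 0 := by
      apply hom_ext_ev
      intro w
      obtain ⟨s, hs⟩ := h w
      rw [ev_comp, ← hs, ← ev_comp, cokernel.condition, ev_zero, ev_zero]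
    refine (Subobject.factors_iff _ _).2 ?_
    let S := ShortComplex.mk P.arrow (cokernel.π P.arrow) (cokernel.condition _)
    have hS : S.Exact := ShortComplex.exact_of_g_is_cokernel _ (cokernelIsCokernel _)
    have : Mono S.f := inferInstanceAs (Mono P.arrow)
    obtain ⟨l, hl⟩ := hS.lift' f h0
    exact (P.factors_iff f).1 (hl ▸ Subobject.factors_comp_arrow (P := P) l)

lemma factors_arrow_iff {P : Subobject X} {Q : Subobject Y} (f : X ⟶ Y) :
    Q.Factors (P.arrow ≫ f) ↔ ∀ x ∈ elements P, ev f x ∈ elements Q := by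
  rw [factors_iff]
  constructor
  · rintro h _ ⟨s, rfl⟩
    simpa using h s
  · intro h w
    simpa using h _ (ev_arrow_mem P w)

lemma le_iff {P Q : Subobject X} : P ≤ Q ↔ ∀ x ∈ elements P, x ∈ elements Q := by
  have := factors_arrow_iff (P := P) (Q := Q) (𝟙 X)
  rw [Category.comp_id] at this
  simp only [ev_id] at this
  rw [← this]
  exact ⟨fun h => Subobject.factors_of_le _ h P.factors_self, Subobject.le_of_factors⟩

lemma elements_mono {P Q : Subobject X} (h : P ≤ Q) {x : El X} (hx : x ∈ elements P) :
    x ∈ elements Q :=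
  le_iff.1 h x hx

@[simp] lemma mem_kernelSubobject (f : X ⟶ Y) (x : El X) :
    x ∈ elements (kernelSubobject f) ↔ ev f x = 0 := by
  constructor
  · rintro ⟨s, rfl⟩
    rw [← ev_comp, kernelSubobject_arrow_comp, ev_zero]
  · intro h
    let S := ShortComplex.mk (kernel.ι f) f (kernel.condition _)
    have hS : S.Exact := ShortComplex.exact_of_f_is_kernel _ (kernelIsKernel _)
    obtain ⟨y, rfl⟩ := exists_of_exact hS x h
    exact (factors_iff (kernelSubobject f) (kernel.ι f)).1
      (by rw [kernelSubobject_factors_iff]; exact kernel.condition f) y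

lemma mem_iff_cokernel (P : Subobject X) (x : El X) :
    x ∈ elements P ↔ ev (cokernel.π P.arrow) x = 0 := by
  constructor
  · rintro ⟨s, rfl⟩
    rw [← ev_comp, cokernel.condition, ev_zero]
  · intro h
    let S := ShortComplex.mk P.arrow (cokernel.π P.arrow) (cokernel.condition _)
    have hS : S.Exact := ShortComplex.exact_of_g_is_cokernel _ (cokernelIsCokernel _)
    exact exists_of_exact hS x h

@[simp] lemma mem_pullback (f : X ⟶ Y) (Q : Subobject Y) (x : El X) :
    x ∈ elements ((Subobject.pullback f).obj Q) ↔ ev f x ∈ elements Q := by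
  constructor
  · exact (factors_arrow_iff f).1 ((FilteredComplex.factors_iff_le_pullback _ _ _).2 le_rfl) x
  · intro h
    rw [mem_iff_cokernel, ← ev_comp, ← mem_kernelSubobject] at h
    refine elements_mono ?_ h
    rw [← FilteredComplex.factors_iff_le_pullback, factors_arrow_iff]
    intro y hy
    rw [mem_iff_cokernel]
    simpa using hy

@[simp] lemma mem_inf (P Q : Subobject X) (x : El X) :
    x ∈ elements (P ⊓ Q) ↔ x ∈ elements P ∧ x ∈ elements Q := by
  constructor
  · exact fun h => ⟨elements_mono inf_le_left h, elements_mono inf_le_right h⟩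
  · rintro ⟨⟨s, rfl⟩, h⟩
    rw [← mem_pullback] at h
    obtain ⟨t, rfl⟩ := h
    rw [← ev_comp]
    refine (factors_iff _ _).1 ((Subobject.inf_factors _).2
      ⟨Subobject.factors_comp_arrow _, ?_⟩) t
    exact (FilteredComplex.factors_iff_le_pullback _ _ _).2 le_rfl

@[simp] lemma mem_imageSubobject (f : X ⟶ Y) (y : El Y) :
    y ∈ elements (imageSubobject f) ↔ ∃ x, ev f x = y := by
  constructor
  · rintro ⟨s, rfl⟩
    obtain ⟨x, rfl⟩ := ev_surjective (factorThruImageSubobject f) s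
    exact ⟨x, by rw [← ev_comp, imageSubobject_arrow_comp]⟩
  · rintro ⟨x, rfl⟩
    exact ⟨ev (factorThruImageSubobject f) x, by rw [← ev_comp, imageSubobject_arrow_comp]⟩

@[simp] lemma mem_sup (P Q : Subobject X) (x : El X) :
    x ∈ elements (P ⊔ Q) ↔ ∃ a ∈ elements P, ∃ b ∈ elements Q, a + b = x := by
  constructor
  · intro h
    have hle : P ⊔ Q ≤ imageSubobject (biprod.desc P.arrow Q.arrow) := by
      refine sup_le ?_ ?_ <;> rw [le_iff] <;> rintro _ ⟨s, rfl⟩ <;> rw [mem_imageSubobject]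
      · exact ⟨ev biprod.inl s, by rw [← ev_comp, biprod.inl_desc]⟩
      · exact ⟨ev biprod.inr s, by rw [← ev_comp, biprod.inr_desc]⟩
    obtain ⟨y, rfl⟩ := (mem_imageSubobject _ _).1 (elements_mono hle h)
    exact ⟨_, ev_arrow_mem P (ev biprod.fst y), _, ev_arrow_mem Q (ev biprod.snd y), by
      rw [← ev_comp, ← ev_comp, ← ev_add, biprod.desc_eq]⟩
  · rintro ⟨a, ha, b, hb, rfl⟩
    exact add_mem (elements_mono le_sup_left ha) (elements_mono le_sup_right hb)

@[simp] lemma mem_top (x : El X) : x ∈ elements (⊤ : Subobject X) := by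
  simpa using (factors_iff (⊤ : Subobject X) (𝟙 X)).1 (Subobject.top_factors _) x

@[simp] lemma mem_bot (x : El X) : x ∈ elements (⊥ : Subobject X) ↔ x = 0 := by
  constructor
  · rintro ⟨s, rfl⟩
    rw [Subobject.bot_arrow, ev_zero]
  · rintro rfl
    exact zero_mem _

lemma eq_top_iff_elements {P : Subobject X} : P = ⊤ ↔ ∀ x, x ∈ elements P := by
  rw [eq_top_iff, le_iff]
  exact ⟨fun h x => h x (mem_top x), fun h x _ => h x⟩

lemma eq_bot_iff_elements {P : Subobject X} : P = ⊥ ↔ ∀ x ∈ elements P, x = 0 := by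
  rw [eq_bot_iff, le_iff]
  simp

lemma el_eq_zero_of_isZero (h : IsZero X) (x : El X) : x = 0 := by
  rw [← ev_id x, h.eq_of_src (𝟙 X) 0, ev_zero]

/-- Extension of morphisms to an injective object along a morphism which need not be a
monomorphism. -/
lemma exists_extension {M Y J : A} [Injective J] (m : M ⟶ Y) (t : M ⟶ J)
    (h : ∀ x, ev m x = 0 → ev t x = 0) : ∃ k : Y ⟶ J, m ≫ k = t := by
  have h0 : kernel.ι m ≫ t = 0 := hom_ext_ev fun x => by
    rw [ev_comp, h _ (by rw [← ev_comp, kernel.condition, ev_zero]), ev_zero]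
  have hm : Abelian.factorThruImage m ≫ Abelian.image.ι m = m := Abelian.image.fac m
  have : IsIso (Abelian.coimageImageComparison m) := inferInstance
  refine ⟨Injective.factorThru (cokernel.desc (kernel.ι m) t h0)
    (Abelian.factorThruCoimage m), ?_⟩
  conv_lhs => enter [1]; rw [← Abelian.coimage.fac m]
  rw [Category.assoc, Injective.comp_factorThru]
  exact cokernel.π_desc _ _ _

/-! ### Elements and homology -/

section homology

variable {ι : Type*} {c : ComplexShape ι} (K L : HomologicalComplex A c)

lemma exists_cycle (j k : ι) (hk : c.next j = k) (x : El (K.X j)) (hx : ev (K.d j k) x = 0) :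
    ∃ z : El (K.cycles j), ev (K.iCycles j) z = x :=
  exists_of_exact (S := ShortComplex.mk (K.iCycles j) (K.d j k) (K.iCycles_d j k))
    (ShortComplex.exact_of_f_is_kernel _ (K.cyclesIsKernel j k hk)) x hx

lemma homologyπ_eq_zero_iff (i j : ι) (hi : c.prev j = i) (z : El (K.cycles j)) :
    ev (K.homologyπ j) z = 0 ↔ ∃ t : El (K.X i), ev (K.d i j) t = ev (K.iCycles j) z := by
  constructor
  · intro h
    obtain ⟨t, rfl⟩ := exists_of_exact
      (S := ShortComplex.mk (K.toCycles i j) (K.homologyπ j) (K.toCycles_comp_homologyπ i j))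
      (ShortComplex.exact_of_g_is_cokernel _ (K.homologyIsCokernel i j hi)) z h
    exact ⟨t, by rw [← ev_comp, K.toCycles_i]⟩
  · rintro ⟨t, ht⟩
    have : z = ev (K.toCycles i j) t := by
      apply ev_injective (K.iCycles j)
      rw [← ev_comp, K.toCycles_i, ht]
    rw [this, ← ev_comp, K.toCycles_comp_homologyπ, ev_zero]

variable {K L}

lemma mono_homologyMap_iff (f : K ⟶ L) (i j k : ι) (hi : c.prev j = i) (hk : c.next j = k) :
    Mono (HomologicalComplex.homologyMap f j) ↔
      ∀ (x : El (K.X j)) (t : El (L.X i)), ev (K.d j k) x = 0 → ev (f.f j) x = ev (L.d i j) t →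
        ∃ s : El (K.X i), ev (K.d i j) s = x := by
  rw [← ev_injective_iff, injective_iff_map_eq_zero]
  constructor
  · intro h x t hx hxt
    obtain ⟨z, rfl⟩ := exists_cycle K j k hk x hx
    refine (homologyπ_eq_zero_iff K i j hi z).1 (h _ ?_)
    rw [← ev_comp, HomologicalComplex.homologyπ_naturality, ev_comp,
      homologyπ_eq_zero_iff L i j hi]
    exact ⟨t, by rw [← hxt, ← ev_comp, ← ev_comp, HomologicalComplex.cyclesMap_i]⟩
  · intro h y hy
    obtain ⟨z, rfl⟩ := ev_surjective (K.homologyπ j) y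
    rw [← ev_comp, HomologicalComplex.homologyπ_naturality, ev_comp,
      homologyπ_eq_zero_iff L i j hi] at hy
    obtain ⟨t, ht⟩ := hy
    rw [homologyπ_eq_zero_iff K i j hi]
    refine h _ t (by rw [← ev_comp, K.iCycles_d, ev_zero]) ?_
    rw [ht, ← ev_comp, ← ev_comp, HomologicalComplex.cyclesMap_i]

lemma epi_homologyMap_iff (f : K ⟶ L) (i j k : ι) (hi : c.prev j = i) (hk : c.next j = k) :
    Epi (HomologicalComplex.homologyMap f j) ↔
      ∀ y : El (L.X j), ev (L.d j k) y = 0 →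
        ∃ (x : El (K.X j)) (t : El (L.X i)), ev (K.d j k) x = 0 ∧
          y = ev (f.f j) x + ev (L.d i j) t := by
  rw [← ev_surjective_iff]
  constructor
  · intro h y hy
    obtain ⟨z, rfl⟩ := exists_cycle L j k hk y hy
    obtain ⟨e, he⟩ := h (ev (L.homologyπ j) z)
    obtain ⟨w, rfl⟩ := ev_surjective (K.homologyπ j) e
    rw [← ev_comp, HomologicalComplex.homologyπ_naturality, ev_comp, ← sub_eq_zero,
      ← map_sub, homologyπ_eq_zero_iff L i j hi] at he
    obtain ⟨t, ht⟩ := he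
    refine ⟨ev (K.iCycles j) w, -t, by rw [← ev_comp, K.iCycles_d, ev_zero], ?_⟩
    rw [map_neg, ht, map_sub, ← ev_comp, ← ev_comp, HomologicalComplex.cyclesMap_i]
    abel
  · intro h e
    obtain ⟨z, rfl⟩ := ev_surjective (L.homologyπ j) e
    obtain ⟨x, t, hx, hxt⟩ := h (ev (L.iCycles j) z) (by rw [← ev_comp, L.iCycles_d, ev_zero])
    obtain ⟨w, rfl⟩ := exists_cycle K j k hk x hx
    refine ⟨ev (K.homologyπ j) w, ?_⟩
    rw [← ev_comp, HomologicalComplex.homologyπ_naturality, ev_comp, ← sub_eq_zero,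
      ← map_sub, homologyπ_eq_zero_iff L i j hi]
    refine ⟨-t, ?_⟩
    rw [map_neg, map_sub, hxt, ← ev_comp, ← ev_comp, HomologicalComplex.cyclesMap_i]
    abel

/-- Quasi-isomorphisms of complexes in terms of elements. -/
lemma quasiIso_iff_elements (f : K ⟶ L) :
    QuasiIso f ↔
      (∀ i j k, c.prev j = i → c.next j = k → ∀ (x : El (K.X j)) (t : El (L.X i)),
        ev (K.d j k) x = 0 → ev (f.f j) x = ev (L.d i j) t →
          ∃ s : El (K.X i), ev (K.d i j) s = x) ∧
      (∀ i j k, c.prev j = i → c.next j = k → ∀ y : El (L.X j), ev (L.d j k) y = 0 →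
        ∃ (x : El (K.X j)) (t : El (L.X i)), ev (K.d j k) x = 0 ∧
          y = ev (f.f j) x + ev (L.d i j) t) := by
  have h1 : QuasiIso f ↔ ∀ j, Mono (HomologicalComplex.homologyMap f j) ∧
      Epi (HomologicalComplex.homologyMap f j) := by
    rw [quasiIso_iff]
    refine forall_congr' fun j => ?_
    rw [quasiIsoAt_iff_isIso_homologyMap]
    exact ⟨fun _ => ⟨inferInstance, inferInstance⟩, fun ⟨_, _⟩ => isIso_of_mono_of_epi _⟩
  rw [h1]
  constructor
  · intro h
    exact ⟨fun i j k hi hk => (mono_homologyMap_iff f i j k hi hk).1 (h j).1,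
      fun i j k hi hk => (epi_homologyMap_iff f i j k hi hk).1 (h j).2⟩
  · rintro ⟨h, h'⟩ j
    exact ⟨(mono_homologyMap_iff f _ j _ rfl rfl).2 (h _ j _ rfl rfl),
      (epi_homologyMap_iff f _ j _ rfl rfl).2 (h' _ j _ rfl rfl)⟩

end homology

/-! ### Elements of subquotients -/

section subquotient

open FilteredComplex

lemma cokernel_π_ofLE_eq_zero_iff {P Q : Subobject X} (h : P ≤ Q) (s : El (Q : A)) :
    ev (cokernel.π (P.ofLE Q h)) s = 0 ↔ ev Q.arrow s ∈ elements P := by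
  constructor
  · intro hs
    obtain ⟨t, rfl⟩ := exists_of_exact
      (S := ShortComplex.mk _ _ (cokernel.condition (P.ofLE Q h)))
      (ShortComplex.exact_of_g_is_cokernel _ (cokernelIsCokernel _)) s hs
    rw [← ev_comp, Subobject.ofLE_arrow]
    exact ev_arrow_mem _ _
  · rintro ⟨t, ht⟩
    have : s = ev (P.ofLE Q h) t := by
      apply ev_injective Q.arrow
      rw [← ev_comp, Subobject.ofLE_arrow, ht]
    rw [this, ← ev_comp, cokernel.condition, ev_zero]

/-- The class in the subquotient `S / (S ∩ T)` of an element which belongs to `S`. -/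
def cls (S T : Subobject X) (x : El X) (hx : x ∈ elements S) : El (subquotient S T) :=
  ev (cokernel.π ((S ⊓ T).ofLE S inf_le_left)) hx.choose

lemma ev_choose {S : Subobject X} {x : El X} (hx : x ∈ elements S) :
    ev S.arrow hx.choose = x := hx.choose_spec

lemma cls_eq_zero_iff {S T : Subobject X} {x : El X} (hx : x ∈ elements S) :
    cls S T x hx = 0 ↔ x ∈ elements T := by
  rw [cls, cokernel_π_ofLE_eq_zero_iff, ev_choose, mem_inf, and_iff_right hx]

lemma cls_sub {S T : Subobject X} {x y : El X} (hx : x ∈ elements S) (hy : y ∈ elements S) :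
    cls S T x hx - cls S T y hy = cls S T (x - y) (sub_mem hx hy) := by
  unfold cls
  rw [← map_sub]
  congr 1
  apply ev_injective S.arrow
  rw [map_sub, ev_choose, ev_choose, ev_choose]

lemma cls_add {S T : Subobject X} {x y : El X} (hx : x ∈ elements S) (hy : y ∈ elements S) :
    cls S T x hx + cls S T y hy = cls S T (x + y) (add_mem hx hy) := by
  unfold cls
  rw [← map_add]
  congr 1
  apply ev_injective S.arrow
  rw [map_add, ev_choose, ev_choose, ev_choose]

lemma cls_eq_iff {S T : Subobject X} {x y : El X} (hx : x ∈ elements S) (hy : y ∈ elements S) :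
    cls S T x hx = cls S T y hy ↔ x - y ∈ elements T := by
  rw [← sub_eq_zero, cls_sub, cls_eq_zero_iff]

lemma exists_cls {S T : Subobject X} (e : El (subquotient S T)) :
    ∃ (x : El X) (hx : x ∈ elements S), cls S T x hx = e := by
  obtain ⟨s, rfl⟩ := ev_surjective (cokernel.π ((S ⊓ T).ofLE S inf_le_left)) e
  refine ⟨ev S.arrow s, ev_arrow_mem _ _, ?_⟩
  unfold cls
  congr 1
  apply ev_injective S.arrow
  rw [ev_choose]

lemma ev_subquotientMap (f : X ⟶ Y) {S T : Subobject X} {S' T' : Subobject Y}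
    (hS : S'.Factors (S.arrow ≫ f)) (hT : T'.Factors ((S ⊓ T).arrow ≫ f))
    (x : El X) (hx : x ∈ elements S) :
    ev (subquotientMap f hS hT) (cls S T x hx) =
      cls S' T' (ev f x) ((factors_arrow_iff f).1 hS x hx) := by
  unfold cls
  rw [← ev_comp, subquotientMap, cokernel.π_desc, ev_comp]
  congr 1
  apply ev_injective S'.arrow
  rw [ev_choose, ← ev_comp, Subobject.factorThru_arrow, ev_comp, ev_choose]

end subquotient

end AbelianElement

/-! ### Elements of filtered objects and of pages -/

namespace FilteredObject

open AbelianElement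

variable {A : Type u} [Category.{v} A] [Abelian A]

lemma Hom.ev_mem {X Y : FilteredObject A} (f : X ⟶ Y) {p : ℤ} {x : El X.obj}
    (hx : x ∈ elements (X.F p)) : ev f.hom x ∈ elements (Y.F p) :=
  (factors_arrow_iff f.hom).1 (f.factors p) x hx

lemma mem_of_le (X : FilteredObject A) {p q : ℤ} (h : p ≤ q) {x : El X.obj}
    (hx : x ∈ elements (X.F q)) : x ∈ elements (X.F p) :=
  elements_mono (X.antitone h) hx

/-- A morphism of filtered objects, from its effect on elements. -/
def homMk {X Y : FilteredObject A} (f : X.obj ⟶ Y.obj)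
    (hf : ∀ p, ∀ x ∈ elements (X.F p), ev f x ∈ elements (Y.F p)) : X ⟶ Y :=
  ⟨f, fun p => (factors_arrow_iff f).2 (hf p)⟩

@[simp] lemma homMk_hom {X Y : FilteredObject A} (f : X.obj ⟶ Y.obj)
    (hf : ∀ p, ∀ x ∈ elements (X.F p), ev f x ∈ elements (Y.F p)) : (homMk f hf).hom = f := rfl

lemma exists_forall_mem (X : FilteredObject A) : ∃ a : ℤ, ∀ x, x ∈ elements (X.F a) :=
  X.exists_eq_top.imp fun _ h => eq_top_iff_elements.1 h

lemma exists_eq_zero_of_mem (X : FilteredObject A) :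
    ∃ b : ℤ, ∀ x ∈ elements (X.F b), x = 0 :=
  X.exists_eq_bot.imp fun _ h => eq_bot_iff_elements.1 h

@[simp] lemma sub_hom {X Y : FilteredObject A} (f g : X ⟶ Y) : (f - g).hom = f.hom - g.hom := by
  rw [sub_eq_add_neg, add_hom, neg_hom, sub_eq_add_neg]

end FilteredObject

namespace FilteredComplex

open AbelianElement FilteredObject

variable {A : Type u} [Category.{v} A] [Abelian A] {K L : CochainComplex (FilteredObject A) ℤ}

@[simp] lemma ev_d_d (i j k : ℤ) (x : El (K.X i).obj) :
    ev (K.d j k).hom (ev (K.d i j).hom x) = 0 := by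
  rw [← ev_comp, d_hom_comp_d_hom, ev_zero]

lemma ev_d_f (f : K ⟶ L) (i j : ℤ) (x : El (K.X i).obj) :
    ev (L.d i j).hom (ev (f.f i).hom x) = ev (f.f j).hom (ev (K.d i j).hom x) := by
  rw [← ev_comp, hom_comm, ev_comp]

lemma mem_Z_iff {r p j k : ℤ} (hjk : j + 1 = k) (x : El (K.X j).obj) :
    x ∈ elements (Z K r p j) ↔
      x ∈ elements ((K.X j).F p) ∧ ev (K.d j k).hom x ∈ elements ((K.X k).F (p + r)) := by
  subst hjk
  rw [Z, mem_inf, mem_pullback]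

lemma mem_B_iff {r p i j : ℤ} (hij : i + 1 = j) (x : El (K.X j).obj) :
    x ∈ elements (B K r p j) ↔
      ∃ b ∈ elements ((K.X j).F (p + 1)), ∃ y ∈ elements ((K.X i).F (p - r + 1)),
        b + ev (K.d i j).hom y = x := by
  obtain rfl : i = j - 1 := by lia
  rw [B, mem_sup]
  constructor
  · rintro ⟨b, hb, c, hc, rfl⟩
    rw [mem_imageSubobject] at hc
    obtain ⟨y, rfl⟩ := hc
    exact ⟨b, hb, _, ev_arrow_mem _ y, by rw [ev_comp]⟩
  · rintro ⟨b, hb, _, ⟨y, rfl⟩, rfl⟩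
    exact ⟨b, hb, _, (mem_imageSubobject _ _).2 ⟨y, rfl⟩, by rw [ev_comp]⟩

lemma mem_B_of_mem {r p j : ℤ} {x : El (K.X j).obj} (hx : x ∈ elements ((K.X j).F (p + 1))) :
    x ∈ elements (B K r p j) :=
  elements_mono le_sup_left hx

lemma ev_E_d {r p i q j : ℤ} (hp : p + r = q) (hij : i + 1 = j) (x : El (K.X i).obj)
    (hx : x ∈ elements (Z K r p i)) :
    ev (E.d K r p i q j) (cls _ (B K r p i) x hx) =
      cls _ (B K r q j) (ev (K.d i j).hom x)
        ((factors_arrow_iff _).1 (factors_Z_d K hp hij) x hx) := by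
  rw [E.d_eq hp hij, ev_subquotientMap]

lemma ev_E_map (f : K ⟶ L) {r p i : ℤ} (x : El (K.X i).obj) (hx : x ∈ elements (Z K r p i)) :
    ev (E.map f r p i) (cls _ (B K r p i) x hx) =
      cls _ (B L r p i) (ev (f.f i).hom x)
        ((factors_arrow_iff _).1 (factors_Z_f f r p i) x hx) := by
  rw [E.map, ev_subquotientMap]

/-- Injectivity of `E_{r+1}(f)`, in terms of elements. The cycles are represented by the elements
`x` of `F^p` with `d x ∈ F^{p+r+1}`, and such a cycle represents zero if and only if it belongs to
`F^{p+1} + d (F^{p-r})`. -/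
def InjectiveOnNextPage (r : ℕ) (f : K ⟶ L) : Prop :=
  ∀ (p i j k : ℤ) (_ : i + 1 = j) (_ : j + 1 = k), ∀ x ∈ elements ((K.X j).F p),
    ev (K.d j k).hom x ∈ elements ((K.X k).F (p + r + 1)) →
    ∀ b ∈ elements ((L.X j).F (p + 1)), ∀ t ∈ elements ((L.X i).F (p - r)),
    ev (f.f j).hom x = b + ev (L.d i j).hom t →
    ∃ b' ∈ elements ((K.X j).F (p + 1)), ∃ t' ∈ elements ((K.X i).F (p - r)),
      x = b' + ev (K.d i j).hom t'

/-- Surjectivity of `E_{r+1}(f)`, in terms of elements, with the same representatives as in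
`InjectiveOnNextPage`. -/
def SurjectiveOnNextPage (r : ℕ) (f : K ⟶ L) : Prop :=
  ∀ (p i j k : ℤ) (_ : i + 1 = j) (_ : j + 1 = k), ∀ y ∈ elements ((L.X j).F p),
    ev (L.d j k).hom y ∈ elements ((L.X k).F (p + r + 1)) →
    ∃ x ∈ elements ((K.X j).F p), ev (K.d j k).hom x ∈ elements ((K.X k).F (p + r + 1)) ∧
    ∃ b ∈ elements ((L.X j).F (p + 1)), ∃ t ∈ elements ((L.X i).F (p - r)),
      y = ev (f.f j).hom x + b + ev (L.d i j).hom t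

/-- A cycle of the page `E_r` is represented by an element `x` of `F^p` with `d x ∈ F^{p+r+1}`. -/
lemma exists_mem_of_ev_E_d_eq_zero {r : ℕ} {p j k : ℤ} (hjk : j + 1 = k)
    {x : El (K.X j).obj} (hx : x ∈ elements (Z K r p j))
    (h : ev (E.d K r p j (p + r) k) (cls _ (B K r p j) x hx) = 0) :
    ∃ y ∈ elements ((K.X j).F (p + 1)),
      ev (K.d j k).hom (x - y) ∈ elements ((K.X k).F (p + r + 1)) := by
  rw [ev_E_d rfl hjk, cls_eq_zero_iff, mem_B_iff hjk] at h
  obtain ⟨b, hb, y, hy, h⟩ := h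
  refine ⟨y, by simpa using hy, ?_⟩
  rw [map_sub, ← h]
  simpa using hb

lemma ev_E_d_eq_zero {r : ℕ} {p j k : ℤ} (hjk : j + 1 = k)
    {x : El (K.X j).obj} (hx : x ∈ elements (Z K r p j))
    (h : ev (K.d j k).hom x ∈ elements ((K.X k).F (p + r + 1))) :
    ev (E.d K r p j (p + r) k) (cls _ (B K r p j) x hx) = 0 := by
  rw [ev_E_d rfl hjk, cls_eq_zero_iff]
  exact mem_B_of_mem h

lemma mem_Z_of_mem {r : ℕ} {p j k : ℤ} (hjk : j + 1 = k) {x : El (K.X j).obj}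
    (hx : x ∈ elements ((K.X j).F p))
    (h : ev (K.d j k).hom x ∈ elements ((K.X k).F (p + r + 1))) :
    x ∈ elements (Z K r p j) :=
  (mem_Z_iff hjk x).2 ⟨hx, mem_of_le _ (by lia) h⟩

/-- The condition that `E_r(f)` is a quasi-isomorphism, with the bidegrees made explicit. -/
lemma page_quasiIso_iff_aux (r : ℕ) (f : K ⟶ L) :
    QuasiIso ((page r).map f) ↔
      (∀ p i j k : ℤ, i + 1 = j → j + 1 = k →
        ∀ (x : El (E K r p j)) (t : El (E L r (p - r) i)),
        ev (E.d K r p j (p + r) k) x = 0 → ev (E.map f r p j) x = ev (E.d L r (p - r) i p j) t →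
          ∃ s : El (E K r (p - r) i), ev (E.d K r (p - r) i p j) s = x) ∧
      (∀ p i j k : ℤ, i + 1 = j → j + 1 = k →
        ∀ y : El (E L r p j), ev (E.d L r p j (p + r) k) y = 0 →
        ∃ (x : El (E K r p j)) (t : El (E L r (p - r) i)), ev (E.d K r p j (p + r) k) x = 0 ∧
          y = ev (E.map f r p j) x + ev (E.d L r (p - r) i p j) t) := by
  have hprev : ∀ p i j : ℤ, i + 1 = j →
      (ComplexShape.up' ((r : ℤ), (1 : ℤ))).prev (p, j) = (p - r, i) := fun p i j h =>
    ComplexShape.prev_eq' _ (Prod.ext (by simp) h)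
  have hnext : ∀ p j k : ℤ, j + 1 = k →
      (ComplexShape.up' ((r : ℤ), (1 : ℤ))).next (p, j) = (p + r, k) := fun p i j h =>
    ComplexShape.next_eq' _ (Prod.ext rfl h)
  rw [quasiIso_iff_elements]
  constructor
  · rintro ⟨h, h'⟩
    constructor
    · intro p i j k hij hjk
      exact h (p - r, i) (p, j) (p + r, k) (hprev p i j hij) (hnext p j k hjk)
    · intro p i j k hij hjk
      exact h' (p - r, i) (p, j) (p + r, k) (hprev p i j hij) (hnext p j k hjk)
  · rintro ⟨h, h'⟩
    constructor
    · rintro _ ⟨p, j⟩ _ hi hk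
      rw [hprev p (j - 1) j (by lia)] at hi
      rw [hnext p j (j + 1) rfl] at hk
      subst hi hk
      exact h p (j - 1) j (j + 1) (by lia) rfl
    · rintro _ ⟨p, j⟩ _ hi hk
      rw [hprev p (j - 1) j (by lia)] at hi
      rw [hnext p j (j + 1) rfl] at hk
      subst hi hk
      exact h' p (j - 1) j (j + 1) (by lia) rfl

lemma injectiveOnNextPage_of_page {r : ℕ} {f : K ⟶ L}
    (h : ∀ p i j k : ℤ, i + 1 = j → j + 1 = k →
      ∀ (x : El (E K r p j)) (t : El (E L r (p - r) i)),
      ev (E.d K r p j (p + r) k) x = 0 → ev (E.map f r p j) x = ev (E.d L r (p - r) i p j) t →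
        ∃ s : El (E K r (p - r) i), ev (E.d K r (p - r) i p j) s = x) :
    InjectiveOnNextPage r f := by
  intro p i j k hij hjk x hx hdx b hb t ht hxt
  have hxZ := mem_Z_of_mem hjk hx hdx
  have hdt : ev (L.d i j).hom t = ev (f.f j).hom x - b := by rw [hxt]; abel
  have htZ : t ∈ elements (Z L r (p - r) i) := by
    rw [mem_Z_iff hij, hdt, sub_add_cancel]
    exact ⟨ht, sub_mem (Hom.ev_mem _ hx) (mem_of_le _ (by lia) hb)⟩
  obtain ⟨s, hs⟩ := h p i j k hij hjk (cls _ (B K r p j) x hxZ)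
    (cls _ (B L r (p - r) i) t htZ) (ev_E_d_eq_zero hjk hxZ hdx) (by
      rw [ev_E_map, ev_E_d (by lia) hij, cls_eq_iff, hdt, sub_sub_cancel]
      exact mem_B_of_mem hb)
  obtain ⟨s, hsZ, rfl⟩ := exists_cls s
  rw [ev_E_d (by lia) hij, eq_comm, cls_eq_iff, mem_B_iff hij] at hs
  obtain ⟨b', hb', y, hy, hs⟩ := hs
  refine ⟨b', hb', y + s, add_mem (mem_of_le _ (by lia) hy) ((mem_Z_iff hij s).1 hsZ).1, ?_⟩
  rw [map_add, ← add_assoc, hs, sub_add_cancel]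

lemma surjectiveOnNextPage_of_page {r : ℕ} {f : K ⟶ L}
    (h' : ∀ p i j k : ℤ, i + 1 = j → j + 1 = k →
      ∀ y : El (E L r p j), ev (E.d L r p j (p + r) k) y = 0 →
      ∃ (x : El (E K r p j)) (t : El (E L r (p - r) i)), ev (E.d K r p j (p + r) k) x = 0 ∧
        y = ev (E.map f r p j) x + ev (E.d L r (p - r) i p j) t) :
    SurjectiveOnNextPage r f := by
  intro p i j k hij hjk y hy hdy
  have hyZ := mem_Z_of_mem hjk hy hdy
  obtain ⟨x, t, hx, hxt⟩ := h' p i j k hij hjk (cls _ (B L r p j) y hyZ)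
    (ev_E_d_eq_zero hjk hyZ hdy)
  obtain ⟨x, hxZ, rfl⟩ := exists_cls x
  obtain ⟨t, htZ, rfl⟩ := exists_cls t
  rw [ev_E_map, ev_E_d (by lia) hij, cls_add, cls_eq_iff, mem_B_iff hij] at hxt
  obtain ⟨b, hb, s, hs, hxt⟩ := hxt
  obtain ⟨z, hz, hxz⟩ := exists_mem_of_ev_E_d_eq_zero hjk hxZ hx
  refine ⟨x - z, sub_mem ((mem_Z_iff hjk x).1 hxZ).1 (mem_of_le _ (by lia) hz), hxz,
    b + ev (f.f j).hom z, add_mem hb (Hom.ev_mem _ hz), s + t,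
    add_mem (mem_of_le _ (by lia) hs) ((mem_Z_iff hij t).1 htZ).1, ?_⟩
  rw [eq_sub_iff_add_eq] at hxt
  rw [← hxt, map_sub, map_add]
  abel

lemma InjectiveOnNextPage.page {r : ℕ} {f : K ⟶ L} (h : InjectiveOnNextPage r f) :
    ∀ p i j k : ℤ, i + 1 = j → j + 1 = k →
      ∀ (x : El (E K r p j)) (t : El (E L r (p - r) i)),
      ev (E.d K r p j (p + r) k) x = 0 → ev (E.map f r p j) x = ev (E.d L r (p - r) i p j) t →
        ∃ s : El (E K r (p - r) i), ev (E.d K r (p - r) i p j) s = x := by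
  intro p i j k hij hjk x t hx hxt
  obtain ⟨x, hxZ, rfl⟩ := exists_cls x
  obtain ⟨t, htZ, rfl⟩ := exists_cls t
  obtain ⟨z, hz, hxz⟩ := exists_mem_of_ev_E_d_eq_zero hjk hxZ hx
  rw [ev_E_map, ev_E_d (by lia) hij, cls_eq_iff, mem_B_iff hij] at hxt
  obtain ⟨b, hb, s, hs, hxt⟩ := hxt
  have hxp := sub_mem ((mem_Z_iff hjk x).1 hxZ).1 (mem_of_le (K.X j) (by lia : p ≤ p + 1) hz)
  obtain ⟨b', hb', t', ht', h⟩ := h p i j k hij hjk (x - z) hxp hxz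
    (b - ev (f.f j).hom z) (sub_mem hb (Hom.ev_mem _ hz)) (s + t)
    (add_mem (mem_of_le _ (by lia) hs) ((mem_Z_iff hij t).1 htZ).1) (by
      rw [eq_sub_iff_add_eq] at hxt
      rw [map_sub, ← hxt, map_add]
      abel)
  have hdt' : ev (K.d i j).hom t' = x - z - b' := by rw [h]; abel
  refine ⟨cls _ _ t' ((mem_Z_iff hij t').2 ⟨ht', ?_⟩), ?_⟩
  · rw [hdt', sub_add_cancel]
    exact sub_mem hxp (mem_of_le _ (by lia) hb')
  · rw [ev_E_d (by lia) hij, cls_eq_iff, hdt']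
    refine mem_B_of_mem ?_
    rw [show x - z - b' - x = -(z + b') by abel]
    exact neg_mem (add_mem hz hb')

lemma SurjectiveOnNextPage.page {r : ℕ} {f : K ⟶ L} (h' : SurjectiveOnNextPage r f) :
    ∀ p i j k : ℤ, i + 1 = j → j + 1 = k →
      ∀ y : El (E L r p j), ev (E.d L r p j (p + r) k) y = 0 →
      ∃ (x : El (E K r p j)) (t : El (E L r (p - r) i)), ev (E.d K r p j (p + r) k) x = 0 ∧
        y = ev (E.map f r p j) x + ev (E.d L r (p - r) i p j) t := by
  intro p i j k hij hjk y hy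
  obtain ⟨y, hyZ, rfl⟩ := exists_cls y
  obtain ⟨z, hz, hyz⟩ := exists_mem_of_ev_E_d_eq_zero hjk hyZ hy
  obtain ⟨x, hx, hdx, b, hb, t, ht, h⟩ := h' p i j k hij hjk (y - z)
    (sub_mem ((mem_Z_iff hjk y).1 hyZ).1 (mem_of_le _ (by lia) hz)) hyz
  have hxZ := mem_Z_of_mem hjk hx hdx
  have hdt : ev (L.d i j).hom t = y - z - ev (f.f j).hom x - b := by rw [h]; abel
  have htZ : t ∈ elements (Z L r (p - r) i) := by
    rw [mem_Z_iff hij, hdt, sub_add_cancel]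
    exact ⟨ht, sub_mem (sub_mem (sub_mem ((mem_Z_iff hjk y).1 hyZ).1
      (mem_of_le _ (by lia) hz)) (Hom.ev_mem _ hx)) (mem_of_le _ (by lia) hb)⟩
  refine ⟨cls _ _ x hxZ, cls _ _ t htZ, ev_E_d_eq_zero hjk hxZ hdx, ?_⟩
  rw [ev_E_map, ev_E_d (by lia) hij, cls_add, cls_eq_iff, hdt]
  refine mem_B_of_mem ?_
  rw [show y - (ev (f.f j).hom x + (y - z - ev (f.f j).hom x - b)) = z + b by abel]
  exact add_mem hz hb

/-- A morphism is an `E_r`-quasi-isomorphism if and only if it is bijective on the next page. -/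
lemma page_quasiIso_iff (r : ℕ) (f : K ⟶ L) :
    QuasiIso ((FilteredComplex.page r).map f) ↔
      InjectiveOnNextPage r f ∧ SurjectiveOnNextPage r f := by
  rw [page_quasiIso_iff_aux]
  exact ⟨fun h => ⟨injectiveOnNextPage_of_page h.1, surjectiveOnNextPage_of_page h.2⟩,
    fun h => ⟨h.1.page, h.2.page⟩⟩

end FilteredComplex

/-! ### The calculus of `r`-homotopies -/

namespace FilteredComplex

open AbelianElement FilteredObject

variable {A : Type u} [Category.{v} A] [Abelian A]

namespace RHomotopy

variable {K L M : CochainComplex (FilteredObject A) ℤ} {r : ℕ}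

/-- The components of an `r`-homotopy, as morphisms of the abelian category. -/
def hom {f g : K ⟶ L} (R : RHomotopy r f g) (n : ℤ) : (K.X (n + 1)).obj ⟶ (L.X n).obj :=
  (R.h n).hom

lemma comm_hom {f g : K ⟶ L} (R : RHomotopy r f g) (n : ℤ) :
    R.hom n ≫ (L.d n (n + 1)).hom + (K.d (n + 1) (n + 1 + 1)).hom ≫ R.hom (n + 1) =
      (g.f (n + 1)).hom - (f.f (n + 1)).hom := by
  refine (congr_arg Hom.hom (R.comm n)).trans ?_
  rw [comp_hom, sub_hom]
  exact Category.id_comp _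

lemma ev_mem {f g : K ⟶ L} (R : RHomotopy r f g) (n : ℤ) {p q : ℤ} (hq : p + r = q)
    {x : El (K.X (n + 1)).obj} (hx : x ∈ elements ((K.X (n + 1)).F q)) :
    ev (R.hom n) x ∈ elements ((L.X n).F p) := by
  subst hq
  exact Hom.ev_mem (X := (shiftFiltration (r : ℤ)).obj (K.X (n + 1))) (R.h n) hx

lemma comm_ev {f g : K ⟶ L} (R : RHomotopy r f g) (n : ℤ) (x : El (K.X (n + 1)).obj) :
    ev (L.d n (n + 1)).hom (ev (R.hom n) x) +
      ev (R.hom (n + 1)) (ev (K.d (n + 1) (n + 1 + 1)).hom x) =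
        ev (g.f (n + 1)).hom x - ev (f.f (n + 1)).hom x := by
  rw [← ev_sub, ← R.comm_hom n, ev_add, ev_comp, ev_comp]

/-- An `r`-homotopy, from its components in the abelian category. -/
def ofHom {f g : K ⟶ L} (h : ∀ n : ℤ, (K.X (n + 1)).obj ⟶ (L.X n).obj)
    (mem : ∀ n p : ℤ, ∀ x ∈ elements ((K.X (n + 1)).F (p + r)),
      ev (h n) x ∈ elements ((L.X n).F p))
    (comm : ∀ n, h n ≫ (L.d n (n + 1)).hom + (K.d (n + 1) (n + 1 + 1)).hom ≫ h (n + 1) =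
      (g.f (n + 1)).hom - (f.f (n + 1)).hom) : RHomotopy r f g where
  h n := homMk (X := (shiftFiltration (r : ℤ)).obj (K.X (n + 1))) (h n) (mem n)
  comm n := by
    refine hom_ext ((comm n).trans ?_)
    rw [comp_hom, sub_hom]
    exact (Category.id_comp _).symm

/-- The constant `r`-homotopy. -/
def refl (f : K ⟶ L) : RHomotopy r f f :=
  ofHom (fun _ => 0) (fun _ _ _ _ => by rw [ev_zero]; exact zero_mem _) (fun n => by simp)

/-- The opposite of an `r`-homotopy. -/
def symm {f g : K ⟶ L} (R : RHomotopy r f g) : RHomotopy r g f :=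
  ofHom (fun n => -R.hom n)
    (fun n p x hx => by rw [ev_neg]; exact neg_mem (R.ev_mem n rfl hx))
    (fun n => by
      rw [Preadditive.neg_comp, Preadditive.comp_neg, ← neg_add, R.comm_hom n, neg_sub])

/-- The sum of two `r`-homotopies. -/
def add {f g f' g' : K ⟶ L} (R : RHomotopy r f g) (R' : RHomotopy r f' g') :
    RHomotopy r (f + f') (g + g') :=
  ofHom (fun n => R.hom n + R'.hom n)
    (fun n p x hx => by rw [ev_add]; exact add_mem (R.ev_mem n rfl hx) (R'.ev_mem n rfl hx))
    (fun n => by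
      rw [Preadditive.add_comp, Preadditive.comp_add, HomologicalComplex.add_f_apply,
        HomologicalComplex.add_f_apply, add_hom, add_hom, add_sub_add_comm, ← R.comm_hom n,
        ← R'.comm_hom n]
      abel)

/-- An `r`-homotopy between morphisms with the same difference. -/
def congr {f g f' g' : K ⟶ L} (R : RHomotopy r f g) (h : g - f = g' - f') : RHomotopy r f' g' :=
  ofHom R.hom (fun n _ _ hx => R.ev_mem n rfl hx) (fun n => by
    rw [R.comm_hom n, ← sub_hom, ← sub_hom, ← HomologicalComplex.sub_f_apply,
      ← HomologicalComplex.sub_f_apply, h])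

/-- The composition of two `r`-homotopies. -/
def trans {f g k : K ⟶ L} (R : RHomotopy r f g) (R' : RHomotopy r g k) : RHomotopy r f k :=
  (R.add R').congr (by abel)

/-- Postcomposition of an `r`-homotopy with a morphism of filtered complexes. -/
def postcomp {f g : K ⟶ L} (R : RHomotopy r f g) (u : L ⟶ M) : RHomotopy r (f ≫ u) (g ≫ u) :=
  ofHom (fun n => R.hom n ≫ (u.f n).hom)
    (fun n p x hx => by rw [ev_comp]; exact Hom.ev_mem _ (R.ev_mem n rfl hx))
    (fun n => by
      rw [Category.assoc, hom_comm, ← Category.assoc, ← Category.assoc, ← Preadditive.add_comp,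
        R.comm_hom n, Preadditive.sub_comp]
      rfl)

/-- Precomposition of an `r`-homotopy with a morphism of filtered complexes. -/
def precomp {f g : K ⟶ L} (R : RHomotopy r f g) (u : M ⟶ K) : RHomotopy r (u ≫ f) (u ≫ g) :=
  ofHom (fun n => (u.f (n + 1)).hom ≫ R.hom n)
    (fun n p x hx => by rw [ev_comp]; exact R.ev_mem n rfl (Hom.ev_mem _ hx))
    (fun n => by
      rw [Category.assoc, ← Category.assoc (M.d _ _).hom, ← hom_comm, Category.assoc,
        ← Preadditive.comp_add, R.comm_hom n, Preadditive.comp_sub]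
      rfl)

/-- The difference of two `r`-homotopic morphisms is zero on the next page. -/
lemma exists_of_mem {f g : K ⟶ L} (R : RHomotopy r f g) {p i j k : ℤ} (hij : i + 1 = j)
    (hjk : j + 1 = k) {x : El (K.X j).obj} (hx : x ∈ elements ((K.X j).F p))
    (hdx : ev (K.d j k).hom x ∈ elements ((K.X k).F (p + r + 1))) :
    ∃ b ∈ elements ((L.X j).F (p + 1)), ∃ t ∈ elements ((L.X i).F (p - r)),
      ev (g.f j).hom x - ev (f.f j).hom x = b + ev (L.d i j).hom t := by
  subst hij hjk
  refine ⟨_, R.ev_mem (i + 1) (add_right_comm p 1 (r : ℤ)) hdx, _,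
    R.ev_mem i (sub_add_cancel p (r : ℤ)) hx, ?_⟩
  exact (R.comm_ev i x).symm.trans (add_comm _ _)

end RHomotopy

variable {K L M : CochainComplex (FilteredObject A) ℤ} {r : ℕ}

/-- An inverse up to `r`-homotopy is an inverse on the next page. -/
lemma page_quasiIso_of_rHomotopy (f : K ⟶ L) (g : L ⟶ K) (R : RHomotopy r (f ≫ g) (𝟙 K))
    (R' : RHomotopy r (g ≫ f) (𝟙 L)) : QuasiIso ((page r).map f) := by
  rw [page_quasiIso_iff]
  constructor
  · intro p i j k hij hjk x hx hdx b hb t ht h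
    obtain ⟨b', hb', t', ht', h'⟩ := R.exists_of_mem hij hjk hx hdx
    refine ⟨b' + ev (g.f j).hom b, add_mem hb' (Hom.ev_mem _ hb), t' + ev (g.f i).hom t,
      add_mem ht' (Hom.ev_mem _ ht), ?_⟩
    rw [HomologicalComplex.id_f, id_hom, ev_id, HomologicalComplex.comp_f, comp_hom, ev_comp, h,
      map_add, sub_eq_iff_eq_add] at h'
    rw [h', map_add, ev_d_f]
    abel
  · intro p i j k hij hjk y hy hdy
    obtain ⟨b, hb, t, ht, h⟩ := R'.exists_of_mem hij hjk hy hdy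
    refine ⟨ev (g.f j).hom y, Hom.ev_mem _ hy, ?_, b, hb, t, ht, ?_⟩
    · rw [ev_d_f]
      exact Hom.ev_mem _ hdy
    · rw [HomologicalComplex.id_f, id_hom, ev_id, HomologicalComplex.comp_f, comp_hom, ev_comp,
        sub_eq_iff_eq_add] at h
      rw [add_assoc, ← h.trans (add_comm _ _)]

variable (A) in
/-- The relation of `r`-homotopy between morphisms of bounded below filtered complexes. -/
def rHomotopic (r : ℕ) : HomRel (CochainComplex.Plus (FilteredObject A)) :=
  fun _ _ f g => Nonempty (RHomotopy r f.hom g.hom)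

instance : Congruence (rHomotopic A r) where
  equivalence := ⟨fun f => ⟨.refl f.hom⟩, fun ⟨R⟩ => ⟨R.symm⟩, fun ⟨R⟩ ⟨R'⟩ => ⟨R.trans R'⟩⟩
  comp_left f _ _ := fun ⟨R⟩ => ⟨R.precomp f.hom⟩
  comp_right g := fun ⟨R⟩ => ⟨R.postcomp g.hom⟩

lemma isCategoryWithStrongAndWeakEquivalences (r : ℕ) :
    CartanEilenberg.IsCategoryWithStrongAndWeakEquivalences
      (rHomotopyEquivalences A r) (rQuasiIsomorphisms A r) where
  isomorphisms_le_strong := by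
    intro K L f (hf : IsIso f)
    refine ⟨inv f, ?_, ?_⟩
    · rw [IsIso.hom_inv_id]
      exact ⟨.refl _⟩
    · rw [IsIso.inv_hom_id]
      exact ⟨.refl _⟩
  isomorphisms_le_weak := by
    intro K L f (hf : IsIso f)
    have : IsIso f.hom := inferInstanceAs (IsIso ((CochainComplex.plus _).ι.map f))
    exact inferInstanceAs (QuasiIso ((page r).map f.hom))
  strong_comp := by
    refine ⟨?_⟩
    intro K L M f g ⟨f', hf, hf'⟩ ⟨g', hg, hg'⟩
    refine ⟨g' ≫ f', ?_, ?_⟩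
    · obtain ⟨R⟩ := hf
      obtain ⟨R'⟩ := hg
      exact ⟨((((R'.postcomp f'.hom).precomp f.hom).congr (by simp)).trans R)⟩
    · obtain ⟨R⟩ := hf'
      obtain ⟨R'⟩ := hg'
      exact ⟨((((R.postcomp g.hom).precomp g'.hom).congr (by simp)).trans R')⟩
  weak_comp := by
    refine ⟨?_⟩
    intro K L M f g (hf : QuasiIso _) (hg : QuasiIso _)
    change QuasiIso ((page r).map (f.hom ≫ g.hom))
    rw [Functor.map_comp]
    infer_instance
  strong_le_weak := by
    rintro K L f ⟨g, ⟨R⟩, ⟨R'⟩⟩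
    exact page_quasiIso_of_rHomotopy _ _ R R'

end FilteredComplex

/-! ### Localizations of a category with a homotopy relation -/

namespace CartanEilenberg

variable {C : Type*} [Category* C] (rel : HomRel C) (V : MorphismProperty C)

/-- An object `M` is `V`-local up to the congruence `rel` if every `w : Y ⟶ X` in `V` induces a
bijection from the classes of morphisms `X ⟶ M` to the classes of morphisms `Y ⟶ M`. -/
structure IsLocalUpTo (M : C) : Prop where
  exists_lift : ∀ ⦃X Y : C⦄ (w : Y ⟶ X), V w → ∀ a : Y ⟶ M, ∃ b : X ⟶ M, rel (w ≫ b) a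
  injective : ∀ ⦃X Y : C⦄ (w : Y ⟶ X), V w → ∀ b b' : X ⟶ M, rel (w ≫ b) (w ≫ b') → rel b b'

variable {rel V} {M : C}

/-- If related morphisms become equal in the localization, every morphism of the localization to
a local object comes from a morphism of the category. -/
lemma IsLocalUpTo.exists_map_eq (hM : IsLocalUpTo rel V M)
    (hV : ∀ ⦃X Y : C⦄ (f g : X ⟶ Y), rel f g → V.Q.map f = V.Q.map g) {X : C}
    (φ : V.Q.obj X ⟶ V.Q.obj M) : ∃ f : X ⟶ M, V.Q.map f = φ := by
  -- the morphisms with which one may precompose without leaving the image of `V.Q`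
  let P : MorphismProperty V.Localization := fun X Y ψ =>
    ∀ a : (Localization.Construction.objEquiv V).symm Y ⟶ M,
      ∃ b : (Localization.Construction.objEquiv V).symm X ⟶ M,
        V.Q.map b = (ψ ≫ V.Q.map a : _ ⟶ V.Q.obj M)
  have : P.IsStableUnderComposition := ⟨fun f g hf hg a => by
    obtain ⟨b, hb⟩ := hg a
    obtain ⟨c, hc⟩ := hf b
    exact ⟨c, hc.trans ((congr_arg (f ≫ ·) hb).trans (Category.assoc _ _ _).symm)⟩⟩
  have hP : P = ⊤ := by
    refine Localization.Construction.morphismProperty_eq_top P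
      (fun X Y f a => ⟨f ≫ a, V.Q.map_comp _ _⟩) (fun Y X w hw a => ?_)
    obtain ⟨b, hb⟩ := hM.exists_lift w hw a
    refine ⟨b, ?_⟩
    have h := hV _ _ hb
    rw [Functor.map_comp] at h
    exact (Iso.eq_inv_comp (Localization.Construction.wIso w hw)).2 h
  have hφ : P φ := hP ▸ MorphismProperty.top_apply φ
  obtain ⟨b, hb⟩ := hφ (𝟙 M)
  refine ⟨b, hb.trans ?_⟩
  have := V.Q.map_id M
  exact (congr_arg (φ ≫ ·) this).trans (Category.comp_id _)

lemma map_eq_of_isInvertedBy {D : Type*} [Category* D] {G : C ⥤ D} (hG : V.IsInvertedBy G)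
    {X Y : C} {f g : X ⟶ Y} (h : V.Q.map f = V.Q.map g) : G.map f = G.map g := by
  have := congr_arg (Localization.Construction.lift G hG).map h
  rw [← Functor.comp_map, ← Functor.comp_map] at this
  have e := Localization.Construction.fac G hG
  rw [Functor.congr_hom e f, Functor.congr_hom e g] at this
  rwa [cancel_epi, cancel_mono] at this

/-- The classes of morphisms to a local object form a presheaf which factors through the
localization, hence the localization identifies no more morphisms than the congruence. -/
lemma IsLocalUpTo.rel_of_map_eq [Congruence rel] (hM : IsLocalUpTo rel V M) {X : C} (f g : X ⟶ M)
    (h : V.Q.map f = V.Q.map g) : rel f g := by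
  let G : Cᵒᵖ ⥤ Type _ := (Quotient.functor rel).op ⋙ yoneda.obj ((Quotient.functor rel).obj M)
  have hG : V.IsInvertedBy G.rightOp := by
    intro Y X w hw
    have : IsIso (G.map w.op) := by
      rw [isIso_iff_bijective]
      constructor
      · intro b b' hb
        obtain ⟨b, rfl⟩ := (Quotient.functor rel).map_surjective b
        obtain ⟨b', rfl⟩ := (Quotient.functor rel).map_surjective b'
        rw [Quotient.functor_map_eq_iff]
        refine hM.injective w hw b b' ?_
        rw [← Quotient.functor_map_eq_iff rel, Functor.map_comp, Functor.map_comp]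
        exact hb
      · intro a
        obtain ⟨a, rfl⟩ := (Quotient.functor rel).map_surjective a
        obtain ⟨b, hb⟩ := hM.exists_lift w hw a
        refine ⟨(Quotient.functor rel).map b, ?_⟩
        rw [← Quotient.functor_map_eq_iff rel, Functor.map_comp] at hb
        exact hb
    exact inferInstanceAs (IsIso (G.map w.op).op)
  have h1 : G.rightOp.map f = G.rightOp.map g := by
    exact map_eq_of_isInvertedBy hG h
  have h2 : G.map f.op = G.map g.op := Quiver.Hom.op_inj h1
  have h3 : (Quotient.functor rel).map f ≫ 𝟙 _ = (Quotient.functor rel).map g ≫ 𝟙 _ :=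
    ConcreteCategory.congr_hom (C := Type _) h2 (𝟙 ((Quotient.functor rel).obj M))
  rw [← Quotient.functor_map_eq_iff rel]
  simpa using h3

end CartanEilenberg

/-! ### Filtered biproducts and cones -/

namespace FilteredObject

open AbelianElement ZeroObject

variable {A : Type u} [Category.{v} A] [Abelian A]

/-- The zero object, with its only filtration. -/
def zero (A : Type u) [Category.{v} A] [Abelian A] : FilteredObject A where
  obj := 0
  F _ := ⊤
  antitone _ _ _ := le_rfl
  exists_eq_top := ⟨0, rfl⟩
  exists_eq_bot := ⟨0, eq_bot_iff_elements.2 fun x _ => el_eq_zero_of_isZero (isZero_zero A) x⟩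

/-- The direct sum of two filtered objects. -/
def prod (X Y : FilteredObject A) : FilteredObject A where
  obj := X.obj ⊞ Y.obj
  F p := (Subobject.pullback biprod.fst).obj (X.F p) ⊓
    (Subobject.pullback biprod.snd).obj (Y.F p)
  antitone p q h := by
    rw [le_iff]
    intro x hx
    rw [mem_inf, mem_pullback, mem_pullback] at hx ⊢
    exact ⟨mem_of_le X h hx.1, mem_of_le Y h hx.2⟩
  exists_eq_top := by
    obtain ⟨a, ha⟩ := X.exists_forall_mem
    obtain ⟨b, hb⟩ := Y.exists_forall_mem
    refine ⟨min a b, eq_top_iff_elements.2 fun x => ?_⟩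
    rw [mem_inf, mem_pullback, mem_pullback]
    exact ⟨mem_of_le X (min_le_left _ _) (ha _), mem_of_le Y (min_le_right _ _) (hb _)⟩
  exists_eq_bot := by
    obtain ⟨a, ha⟩ := X.exists_eq_zero_of_mem
    obtain ⟨b, hb⟩ := Y.exists_eq_zero_of_mem
    refine ⟨max a b, eq_bot_iff_elements.2 fun x hx => ?_⟩
    rw [mem_inf, mem_pullback, mem_pullback] at hx
    have h := congr_arg (fun f => ev f x) (biprod.total (X := X.obj) (Y := Y.obj))
    simp only [ev_add, ev_comp, ev_id] at h
    rw [← h, ha _ (mem_of_le X (le_max_left _ _) hx.1),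
      hb _ (mem_of_le Y (le_max_right _ _) hx.2), map_zero, map_zero, add_zero]

lemma mem_prod_iff (X Y : FilteredObject A) (p : ℤ) (x : El (X.obj ⊞ Y.obj)) :
    x ∈ elements ((X.prod Y).F p) ↔
      ev biprod.fst x ∈ elements (X.F p) ∧ ev biprod.snd x ∈ elements (Y.F p) := by
  change x ∈ elements (_ ⊓ _) ↔ _
  rw [mem_inf, mem_pullback, mem_pullback]

lemma prod_inl_mem (X Y : FilteredObject A) (p : ℤ) (x : El X.obj) (hx : x ∈ elements (X.F p)) :
    ev (biprod.inl : X.obj ⟶ X.obj ⊞ Y.obj) x ∈ elements ((X.prod Y).F p) := by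
  rw [mem_prod_iff, ← ev_comp, ← ev_comp, biprod.inl_fst, biprod.inl_snd, ev_id, ev_zero]
  exact ⟨hx, zero_mem _⟩

lemma prod_inr_mem (X Y : FilteredObject A) (p : ℤ) (y : El Y.obj) (hy : y ∈ elements (Y.F p)) :
    ev (biprod.inr : Y.obj ⟶ X.obj ⊞ Y.obj) y ∈ elements ((X.prod Y).F p) := by
  rw [mem_prod_iff, ← ev_comp, ← ev_comp, biprod.inr_fst, biprod.inr_snd, ev_id, ev_zero]
  exact ⟨zero_mem _, hy⟩

/-- The direct sum of two filtered objects, as a biproduct. -/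
def prodBicone (X Y : FilteredObject A) : BinaryBicone X Y where
  pt := X.prod Y
  fst := homMk (X := X.prod Y) biprod.fst fun _ x hx => ((mem_prod_iff X Y _ x).1 hx).1
  snd := homMk (X := X.prod Y) biprod.snd fun _ x hx => ((mem_prod_iff X Y _ x).1 hx).2
  inl := homMk (Y := X.prod Y) biprod.inl fun p x hx => prod_inl_mem X Y p x hx
  inr := homMk (Y := X.prod Y) biprod.inr fun p x hx => prod_inr_mem X Y p x hx
  inl_fst := hom_ext biprod.inl_fst
  inl_snd := hom_ext biprod.inl_snd
  inr_fst := hom_ext biprod.inr_fst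
  inr_snd := hom_ext biprod.inr_snd

instance : HasBinaryBiproducts (FilteredObject A) :=
  ⟨fun X Y => hasBinaryBiproduct_of_total (prodBicone X Y) (hom_ext biprod.total)⟩

instance (s : ℤ) : (shiftFiltration (A := A) s).Additive where

lemma eq_zero_of_isZero {X : FilteredObject A} (h : IsZero X) (x : El X.obj) : x = 0 := by
  have := congr_arg (fun f => ev (Hom.hom f) x) (h.eq_of_src (𝟙 X) 0)
  simpa using this

lemma isZero_iff {X : FilteredObject A} : IsZero X ↔ ∀ x : El X.obj, x = 0 := by
  refine ⟨eq_zero_of_isZero, fun h => ?_⟩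
  rw [IsZero.iff_id_eq_zero]
  refine hom_ext (hom_ext_ev fun x => ?_)
  rw [h x, map_zero, map_zero]

end FilteredObject

namespace FilteredComplex

open AbelianElement FilteredObject

variable {A : Type u} [Category.{v} A] [Abelian A]

/-- The morphism of complexes from `K`, with the filtration `F(r)`, to `K`. -/
def shiftToId (r : ℕ) (K : CochainComplex (FilteredObject A) ℤ) :
    ((shiftFiltration (r : ℤ)).mapHomologicalComplex _).obj K ⟶ K where
  f n := (shiftFiltrationToId r).app (K.X n)
  comm' _ _ _ := ((shiftFiltrationToId r).naturality _).symm

variable {K L M : CochainComplex (FilteredObject A) ℤ} (r : ℕ) (w : K ⟶ L)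

/-- The `r`-cone of `w : K ⟶ L`: in degree `n`, it is the direct sum of `L^n` and of
`K^{n+1}` with the filtration `F(r)`. -/
abbrev cone : CochainComplex (FilteredObject A) ℤ :=
  CochainComplex.mappingCone (shiftToId r K ≫ w)

namespace cone

open CochainComplex

/-- The projection to `K^{n+1}`. -/
def fst (n : ℤ) : ((cone r w).X n).obj ⟶ (K.X (n + 1)).obj :=
  ((mappingCone.fst (shiftToId r K ≫ w)).1.v n (n + 1) rfl).hom

/-- The projection to `L^n`. -/
def snd (n : ℤ) : ((cone r w).X n).obj ⟶ (L.X n).obj :=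
  ((mappingCone.snd (shiftToId r K ≫ w)).v n n (add_zero n)).hom

/-- The inclusion of `K^{n+1}`. -/
def inl (n : ℤ) : (K.X (n + 1)).obj ⟶ ((cone r w).X n).obj :=
  ((mappingCone.inl (shiftToId r K ≫ w)).v (n + 1) n (by lia)).hom

/-- The inclusion of `L^n`. -/
def inr (n : ℤ) : (L.X n).obj ⟶ ((cone r w).X n).obj :=
  ((mappingCone.inr (shiftToId r K ≫ w)).f n).hom

variable (n : ℤ)

@[simp] lemma inl_fst : inl r w n ≫ fst r w n = 𝟙 _ :=
  congr_arg Hom.hom (mappingCone.inl_v_fst_v (shiftToId r K ≫ w) (n + 1) n rfl)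

@[simp] lemma inl_snd : inl r w n ≫ snd r w n = 0 :=
  congr_arg Hom.hom (mappingCone.inl_v_snd_v (shiftToId r K ≫ w) (n + 1) n (by lia))

@[simp] lemma inr_fst : inr r w n ≫ fst r w n = 0 :=
  congr_arg Hom.hom (mappingCone.inr_f_fst_v (shiftToId r K ≫ w) n (n + 1) rfl)

@[simp] lemma inr_snd : inr r w n ≫ snd r w n = 𝟙 _ :=
  congr_arg Hom.hom (mappingCone.inr_f_snd_v (shiftToId r K ≫ w) n)

lemma total : fst r w n ≫ inl r w n + snd r w n ≫ inr r w n = 𝟙 _ :=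
  congr_arg Hom.hom (mappingCone.id_X (shiftToId r K ≫ w) n (n + 1) rfl)

lemma d_fst : ((cone r w).d n (n + 1)).hom ≫ fst r w (n + 1) =
    -(fst r w n ≫ (K.d (n + 1) (n + 1 + 1)).hom) :=
  congr_arg Hom.hom (mappingCone.d_fst_v (shiftToId r K ≫ w) n (n + 1) (n + 1 + 1) rfl rfl)

lemma d_snd : ((cone r w).d n (n + 1)).hom ≫ snd r w (n + 1) =
    fst r w n ≫ (w.f (n + 1)).hom + snd r w n ≫ (L.d n (n + 1)).hom := by
  refine (congr_arg Hom.hom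
    (mappingCone.d_snd_v (shiftToId r K ≫ w) n (n + 1) rfl)).trans ?_
  rw [add_hom, comp_hom, comp_hom, HomologicalComplex.comp_f, comp_hom]
  congr 2
  exact Category.id_comp _

lemma inr_d : inr r w n ≫ ((cone r w).d n (n + 1)).hom =
    (L.d n (n + 1)).hom ≫ inr r w (n + 1) :=
  congr_arg Hom.hom (mappingCone.inr_f_d (shiftToId r K ≫ w) n (n + 1))

lemma inl_d : inl r w n ≫ ((cone r w).d n (n + 1)).hom =
    (w.f (n + 1)).hom ≫ inr r w (n + 1) - (K.d (n + 1) (n + 1 + 1)).hom ≫ inl r w (n + 1) := by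
  refine (congr_arg Hom.hom
    (mappingCone.inl_v_d (shiftToId r K ≫ w) (n + 1) n (n + 1 + 1) (by lia) (by lia))).trans ?_
  rw [sub_hom, comp_hom, comp_hom, HomologicalComplex.comp_f, comp_hom]
  congr 2
  exact Category.id_comp _

lemma ev_total (x : El ((cone r w).X n).obj) :
    ev (inl r w n) (ev (fst r w n) x) + ev (inr r w n) (ev (snd r w n) x) = x := by
  have := congr_arg (fun f => ev f x) (total r w n)
  simpa only [ev_add, ev_comp, ev_id] using this

@[simp] lemma ev_inl_fst (y : El (K.X (n + 1)).obj) : ev (fst r w n) (ev (inl r w n) y) = y := by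
  rw [← ev_comp, inl_fst, ev_id]

@[simp] lemma ev_inl_snd (y : El (K.X (n + 1)).obj) : ev (snd r w n) (ev (inl r w n) y) = 0 := by
  rw [← ev_comp, inl_snd, ev_zero]

@[simp] lemma ev_inr_fst (x : El (L.X n).obj) : ev (fst r w n) (ev (inr r w n) x) = 0 := by
  rw [← ev_comp, inr_fst, ev_zero]

@[simp] lemma ev_inr_snd (x : El (L.X n).obj) : ev (snd r w n) (ev (inr r w n) x) = x := by
  rw [← ev_comp, inr_snd, ev_id]

lemma inl_mem {p : ℤ} {y : El (K.X (n + 1)).obj} (hy : y ∈ elements ((K.X (n + 1)).F (p + r))) :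
    ev (inl r w n) y ∈ elements (((cone r w).X n).F p) :=
  Hom.ev_mem (X := (shiftFiltration (r : ℤ)).obj (K.X (n + 1)))
    ((mappingCone.inl (shiftToId r K ≫ w)).v (n + 1) n (by lia)) hy

lemma inr_mem {p : ℤ} {x : El (L.X n).obj} (hx : x ∈ elements ((L.X n).F p)) :
    ev (inr r w n) x ∈ elements (((cone r w).X n).F p) :=
  Hom.ev_mem _ hx

lemma fst_mem {p : ℤ} {x : El ((cone r w).X n).obj}
    (hx : x ∈ elements (((cone r w).X n).F p)) :
    ev (fst r w n) x ∈ elements ((K.X (n + 1)).F (p + r)) :=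
  Hom.ev_mem (Y := (shiftFiltration (r : ℤ)).obj (K.X (n + 1)))
    ((mappingCone.fst (shiftToId r K ≫ w)).1.v n (n + 1) rfl) hx

lemma snd_mem {p : ℤ} {x : El ((cone r w).X n).obj}
    (hx : x ∈ elements (((cone r w).X n).F p)) :
    ev (snd r w n) x ∈ elements ((L.X n).F p) :=
  Hom.ev_mem _ hx

lemma ext_ev {x y : El ((cone r w).X n).obj} (h : ev (fst r w n) x = ev (fst r w n) y)
    (h' : ev (snd r w n) x = ev (snd r w n) y) : x = y := by
  rw [← ev_total r w n x, ← ev_total r w n y, h, h']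

lemma ev_d_fst (x : El ((cone r w).X n).obj) :
    ev (fst r w (n + 1)) (ev ((cone r w).d n (n + 1)).hom x) =
      -ev (K.d (n + 1) (n + 1 + 1)).hom (ev (fst r w n) x) := by
  rw [← ev_comp, d_fst, ev_neg, ev_comp]

lemma ev_d_snd (x : El ((cone r w).X n).obj) :
    ev (snd r w (n + 1)) (ev ((cone r w).d n (n + 1)).hom x) =
      ev (w.f (n + 1)).hom (ev (fst r w n) x) + ev (L.d n (n + 1)).hom (ev (snd r w n) x) := by
  rw [← ev_comp, d_snd, ev_add, ev_comp, ev_comp]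

variable {r w}

/-- The morphism from the `r`-cone of `w` given by a morphism `e` from the target of `w` and an
`r`-homotopy from `0` to `w ≫ e`. -/
def desc (e : L ⟶ M) (R : RHomotopy r 0 (w ≫ e)) : cone r w ⟶ M where
  f n := homMk (fst r w n ≫ R.hom n + snd r w n ≫ (e.f n).hom) fun p x hx => by
    rw [ev_add, ev_comp, ev_comp]
    exact add_mem (R.ev_mem n rfl (fst_mem r w n hx)) (Hom.ev_mem _ (snd_mem r w n hx))
  comm' := by
    rintro n _ rfl
    refine hom_ext ?_
    rw [comp_hom, comp_hom, homMk_hom, homMk_hom, Preadditive.add_comp, Preadditive.comp_add,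
      ← Category.assoc, ← Category.assoc (((cone r w).d n (n + 1)).hom), d_fst, d_snd,
      Category.assoc, Category.assoc, hom_comm, Preadditive.add_comp, Preadditive.neg_comp,
      Category.assoc, Category.assoc, Category.assoc]
    have h := R.comm_hom n
    rw [HomologicalComplex.zero_f, zero_hom, sub_zero, HomologicalComplex.comp_f, comp_hom] at h
    rw [← h, Preadditive.comp_add]
    abel

lemma inr_desc (e : L ⟶ M) (R : RHomotopy r 0 (w ≫ e)) :
    mappingCone.inr (shiftToId r K ≫ w) ≫ desc e R = e := by
  ext n
  change inr r w n ≫ (fst r w n ≫ R.hom n + snd r w n ≫ (e.f n).hom) = _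
  rw [Preadditive.comp_add, ← Category.assoc, ← Category.assoc, inr_fst, inr_snd, zero_comp,
    zero_add, Category.id_comp]

lemma isZero_X (h : IsZero (K.X (n + 1))) (h' : IsZero (L.X n)) : IsZero ((cone r w).X n) := by
  refine (FilteredObject.isZero_iff (X := (cone r w).X n)).2 fun x => ?_
  rw [← ev_total r w n x, eq_zero_of_isZero h (ev (fst r w n) x),
    eq_zero_of_isZero h' (ev (snd r w n) x), map_zero, map_zero, add_zero]

end cone

/-- A filtered complex is `r`-acyclic if its page `E_{r+1}` is zero. -/
def RAcyclic (r : ℕ) (K : CochainComplex (FilteredObject A) ℤ) : Prop :=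
  ∀ p n : ℤ, ∀ x ∈ elements ((K.X (n + 1)).F p),
    ev (K.d (n + 1) (n + 1 + 1)).hom x ∈ elements ((K.X (n + 1 + 1)).F (p + r + 1)) →
    ∃ b ∈ elements ((K.X (n + 1)).F (p + 1)), ∃ t ∈ elements ((K.X n).F (p - r)),
      x = b + ev (K.d n (n + 1)).hom t

/-- The `r`-cone of an `E_r`-quasi-isomorphism is `r`-acyclic. -/
lemma rAcyclic_cone {r : ℕ} {w : K ⟶ L} (hw : QuasiIso ((page r).map w)) :
    RAcyclic r (cone r w) := by
  obtain ⟨hi, hs⟩ := (page_quasiIso_iff r w).1 hw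
  intro p n x hx hdx
  have hy := cone.fst_mem r w _ hx
  have hz := cone.snd_mem r w _ hx
  have hdy := cone.fst_mem r w _ hdx
  have hdz := cone.snd_mem r w _ hdx
  rw [cone.ev_d_fst, neg_mem_iff] at hdy
  rw [cone.ev_d_snd] at hdz
  set y := ev (cone.fst r w (n + 1)) x with hydef
  set z := ev (cone.snd r w (n + 1)) x with hzdef
  -- injectivity makes the component in `K` a boundary modulo lower terms; the remaining component
  -- in `L` is then a cycle, to which surjectivity applies
  obtain ⟨b, hb, s, hs', h⟩ := hi (p + r) (n + 1) (n + 1 + 1) (n + 1 + 1 + 1) rfl rfl y hy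
    (mem_of_le _ (by lia) hdy)
    _ hdz (-z) (neg_mem (mem_of_le _ (by lia) hz)) (by rw [map_neg]; abel)
  have hs'' : s ∈ elements ((K.X (n + 1)).F p) := mem_of_le _ (by lia) hs'
  obtain ⟨c, hc, hdc, b', hb', t, ht, h'⟩ := hs p n (n + 1) (n + 1 + 1) rfl rfl
    (z + ev (w.f (n + 1)).hom s) (add_mem hz (Hom.ev_mem _ hs'')) (by
      have : ev (L.d (n + 1) (n + 1 + 1)).hom (z + ev (w.f (n + 1)).hom s) =
          ev (w.f (n + 1 + 1)).hom y + ev (L.d (n + 1) (n + 1 + 1)).hom z -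
            ev (w.f (n + 1 + 1)).hom b := by
        rw [map_add, ev_d_f, h, map_add]
        abel
      rw [this]
      exact sub_mem hdz (Hom.ev_mem _ hb))
  refine ⟨ev (cone.inl r w _) (b + ev (K.d _ _).hom c) + ev (cone.inr r w _) b',
    add_mem (cone.inl_mem r w _ (add_mem (mem_of_le _ (by lia) hb) (mem_of_le _ (by lia) hdc)))
      (cone.inr_mem r w _ hb'),
    ev (cone.inl r w _) (c - s) + ev (cone.inr r w _) t,
    add_mem (cone.inl_mem r w _ (by rw [sub_add_cancel]; exact sub_mem hc hs''))
      (cone.inr_mem r w _ ht), ?_⟩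
  apply cone.ext_ev
  · rw [map_add, cone.ev_d_fst]
    rw [← hydef]
    simp only [map_add, map_sub, cone.ev_inl_fst, cone.ev_inr_fst, add_zero]
    rw [h]
    abel
  · rw [map_add, cone.ev_d_snd]
    simp only [map_add, map_sub, cone.ev_inl_fst, cone.ev_inr_fst, cone.ev_inl_snd,
      cone.ev_inr_snd, map_zero, add_zero, zero_add]
    rw [← hzdef, eq_sub_of_add_eq h']
    abel

end FilteredComplex

/-! ### Filtered injective objects -/

namespace FilteredObject

open AbelianElement

variable {A : Type u} [Category.{v} A] [Abelian A]

/-- The projection of `F^p X` to the graded piece. -/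
def toGr (X : FilteredObject A) (p : ℤ) : (X.F p : A) ⟶ X.gr p := cokernel.π _

lemma toGr_eq_zero_iff (X : FilteredObject A) (p : ℤ) (s : El (X.F p : A)) :
    ev (X.toGr p) s = 0 ↔ ev (X.F p).arrow s ∈ elements (X.F (p + 1)) :=
  cokernel_π_ofLE_eq_zero_iff _ s

/-- The short complex `F^{p+1} X ⟶ F^p X ⟶ Gr^p X`. -/
def grShortComplex (X : FilteredObject A) (p : ℤ) : ShortComplex A :=
  ShortComplex.mk ((X.F (p + 1)).ofLE (X.F p) (X.antitone (by lia))) (X.toGr p)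
    (cokernel.condition _)

lemma grShortComplex_shortExact (X : FilteredObject A) (p : ℤ) :
    (X.grShortComplex p).ShortExact where
  exact := ShortComplex.exact_of_g_is_cokernel _ (cokernelIsCokernel _)
  mono_f := inferInstanceAs (Mono (Subobject.ofLE _ _ _))
  epi_g := coequalizer.π_epi

lemma injective_F {I : FilteredObject A} (hI : ∀ p, Injective (I.gr p)) (p : ℤ) :
    Injective (I.F p : A) := by
  obtain ⟨b, hb⟩ := I.exists_eq_zero_of_mem
  have h0 : ∀ q, b ≤ q → Injective (I.F q : A) := fun q hq => by
    apply IsZero.injective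
    rw [IsZero.iff_id_eq_zero]
    refine hom_ext_ev fun x => ev_injective (I.F q).arrow ?_
    rw [hb _ (mem_of_le I hq (ev_arrow_mem _ _)), ev_zero, map_zero]
  have h1 : ∀ m : ℕ, Injective (I.F (b - m) : A) := by
    intro m
    induction m with
    | zero => exact h0 _ (by lia)
    | succ m ih =>
      have e : b - (m + 1 : ℕ) + 1 = b - m := by lia
      have h1 : Injective (I.grShortComplex (b - (m + 1 : ℕ))).X₁ := by
        change Injective (I.F (b - (m + 1 : ℕ) + 1) : A)
        rwa [e]
      have : Injective (I.grShortComplex (b - (m + 1 : ℕ))).X₃ := hI _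
      exact Injective.of_iso ((I.grShortComplex_shortExact
        (b - (m + 1 : ℕ))).splittingOfInjective).isoBinaryBiproduct.symm inferInstance
  rcases le_total b p with h | h
  · exact h0 p h
  · have := h1 (b - p).toNat
    rwa [show b - ((b - p).toNat : ℤ) = p by lia] at this

lemma exists_section_toGr {I : FilteredObject A} (hI : ∀ p, Injective (I.gr p)) (p : ℤ) :
    ∃ σ : I.gr p ⟶ (I.F p : A), σ ≫ I.toGr p = 𝟙 _ := by
  have : Injective (I.grShortComplex p).X₁ := injective_F hI (p + 1)
  exact ⟨_, ((I.grShortComplex_shortExact p).splittingOfInjective).s_g⟩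

/-- One step in the extension of `w` along `d`: an extension modulo `F^p` is corrected, by means
of the injectivity of `Gr^p`, to an extension modulo `F^{p+1}`. -/
lemma exists_extension_step {I : FilteredObject A} (hI : ∀ p, Injective (I.gr p)) {X : A}
    {Y : FilteredObject A} (d : X ⟶ Y.obj) (w : X ⟶ I.obj)
    (hw : ∀ p x, ev d x ∈ elements (Y.F p) → ev w x ∈ elements (I.F p)) (p : ℤ)
    (h : Y ⟶ I) (hh : ∀ x, ev w x - ev h.hom (ev d x) ∈ elements (I.F p)) :
    ∃ h' : Y ⟶ I, ∀ x, ev w x - ev h'.hom (ev d x) ∈ elements (I.F (p + 1)) := by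
  have hf : (I.F p).Factors (w - d ≫ h.hom) := by
    rw [factors_iff]
    intro x
    rw [ev_sub, ev_comp]
    exact hh x
  obtain ⟨e, he⟩ : ∃ e : X ⟶ (I.F p : A), e ≫ (I.F p).arrow = w - d ≫ h.hom :=
    ⟨_, Subobject.factorThru_arrow _ _ hf⟩
  have hee : ∀ x, ev (I.F p).arrow (ev e x) = ev w x - ev h.hom (ev d x) := fun x => by
    rw [← ev_comp, he, ev_sub, ev_comp]
  have := hI p
  obtain ⟨k, hk⟩ := exists_extension (biprod.desc (Y.F (p + 1)).arrow d)
    (biprod.desc 0 (e ≫ I.toGr p)) (by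
      intro z hz
      rw [biprod.desc_eq, ev_add, ev_comp, ev_comp, add_eq_zero_iff_neg_eq] at hz
      rw [biprod.desc_eq, comp_zero, zero_add, ev_comp, ev_comp, toGr_eq_zero_iff, hee]
      have hd : ev d (ev biprod.snd z) ∈ elements (Y.F (p + 1)) := by
        rw [← hz]
        exact neg_mem (ev_arrow_mem _ _)
      exact sub_mem (hw _ _ hd) (Hom.ev_mem _ hd))
  have hk1 : (Y.F (p + 1)).arrow ≫ k = 0 := by
    simpa using congr_arg (biprod.inl ≫ ·) hk
  have hk2 : d ≫ k = e ≫ I.toGr p := by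
    simpa using congr_arg (biprod.inr ≫ ·) hk
  obtain ⟨σ, hσ⟩ := exists_section_toGr hI p
  have hmem : ∀ q, ∀ y ∈ elements (Y.F q), ev (k ≫ σ ≫ (I.F p).arrow) y ∈ elements (I.F q) := by
    intro q y hy
    rw [ev_comp]
    rcases lt_or_ge p q with hq | hq
    · obtain ⟨s, rfl⟩ := mem_of_le Y hq hy
      rw [← ev_comp _ k, hk1, ev_zero, map_zero]
      exact zero_mem _
    · rw [ev_comp]
      exact mem_of_le I hq (ev_arrow_mem _ _)
  refine ⟨h + homMk _ hmem, fun x => ?_⟩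
  have h1 : ev w x - ev (h + homMk _ hmem).hom (ev d x) =
      ev (I.F p).arrow (ev e x - ev σ (ev (I.toGr p) (ev e x))) := by
    rw [add_hom, ev_add, homMk_hom, map_sub, hee, ← ev_comp e, ← hk2, ev_comp, ev_comp, ev_comp]
    abel
  rw [h1, ← toGr_eq_zero_iff, map_sub, ← ev_comp σ, hσ, ev_id, sub_self]

/-- Extension of morphisms to a filtered object with injective graded pieces: a morphism `w`
extends along `d` to a filtered morphism as soon as it is compatible with the filtration
induced by `d`. -/
lemma exists_filtered_extension {I : FilteredObject A} (hI : ∀ p, Injective (I.gr p)) {X : A}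
    {Y : FilteredObject A} (d : X ⟶ Y.obj) (w : X ⟶ I.obj)
    (hw : ∀ p x, ev d x ∈ elements (Y.F p) → ev w x ∈ elements (I.F p)) :
    ∃ h : Y ⟶ I, d ≫ h.hom = w := by
  obtain ⟨a, ha⟩ := I.exists_forall_mem
  obtain ⟨b, hb⟩ := I.exists_eq_zero_of_mem
  have : ∀ m : ℕ, ∃ h : Y ⟶ I, ∀ x, ev w x - ev h.hom (ev d x) ∈ elements (I.F (a + m)) := by
    intro m
    induction m with
    | zero => exact ⟨0, fun x => by simpa using ha _⟩
    | succ m ih =>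
      obtain ⟨h, hh⟩ := ih
      obtain ⟨h', hh'⟩ := exists_extension_step hI d w hw _ h hh
      refine ⟨h', fun x => ?_⟩
      rw [Nat.cast_succ, ← add_assoc]
      exact hh' x
  obtain ⟨h, hh⟩ := this (b - a).toNat
  refine ⟨h, hom_ext_ev fun x => ?_⟩
  rw [ev_comp, eq_comm, ← sub_eq_zero]
  exact hb _ (mem_of_le I (by lia) (hh x))

end FilteredObject

/-- Dependent choice along the integers, extending a sequence which is given up to some index. -/
lemma exists_int_sequence {β : ℤ → Type*} (P : ∀ n, β n → β (n + 1) → Prop) (N : ℤ)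
    (h₀ : ∀ n, β n) (base : ∀ n ≤ N, P n (h₀ n) (h₀ (n + 1)))
    (step : ∀ n a b, P n a b → ∃ c, P (n + 1) b c) :
    ∃ h : ∀ n, β n, (∀ n ≤ N, h n = h₀ n) ∧ ∀ n, P n (h n) (h (n + 1)) := by
  have hstep : ∀ (m : ℕ) (h : {h : ∀ n, β n // ∀ n ≤ N + m, P n (h n) (h (n + 1))}),
      ∃ h' : {h : ∀ n, β n // ∀ n ≤ N + (m + 1 : ℕ), P n (h n) (h (n + 1))},
        ∀ n ≤ N + m + 1, h'.1 n = h.1 n := by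
    rintro m ⟨h, hh⟩
    obtain ⟨c, hc⟩ := step _ _ _ (hh (N + m) le_rfl)
    refine ⟨⟨Function.update h _ c, fun n hn => ?_⟩, fun n hn =>
      Function.update_of_ne (by lia) _ _⟩
    rcases (show n ≤ N + m ∨ n = N + m + 1 by lia) with hn | rfl
    · rw [Function.update_of_ne (by lia), Function.update_of_ne (by lia)]
      exact hh n hn
    · rw [Function.update_of_ne (by lia), Function.update_self]
      exact hc
  choose next hnext using hstep
  let H : ∀ m : ℕ, {h : ∀ n, β n // ∀ n ≤ N + m, P n (h n) (h (n + 1))} := fun m =>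
    Nat.rec ⟨h₀, fun n hn => base n (by simpa using hn)⟩ next m
  have hH : ∀ m k : ℕ, ∀ n ≤ N + m + 1, (H (m + k)).1 n = (H m).1 n := by
    intro m k n hn
    induction k with
    | zero => rfl
    | succ k ih =>
      rw [← ih]
      exact hnext (m + k) (H (m + k)) n (by push_cast; lia)
  refine ⟨fun n => (H (n - N).toNat).1 n, fun n hn => ?_, fun n => ?_⟩
  · dsimp only
    rw [Int.toNat_of_nonpos (by lia)]
    rfl
  have h1 := (H (n - N).toNat).2 n (by lia)
  obtain ⟨k, hk⟩ : ∃ k, (n + 1 - N).toNat = (n - N).toNat + k := ⟨_, (Nat.add_sub_cancel'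
    (by lia)).symm⟩
  have h2 : (H (n + 1 - N).toNat).1 (n + 1) = (H (n - N).toNat).1 (n + 1) := by
    rw [hk]
    exact hH _ _ _ (by lia)
  change P n _ ((H (n + 1 - N).toNat).1 (n + 1))
  rw [h2]
  exact h1

/-- A family indexed by the integers may be given in degrees written as `n + 1`. -/
lemma exists_of_succ {β : ℤ → Type*} (f : ∀ n, β (n + 1)) :
    ∃ g : ∀ n, β n, ∀ n, g (n + 1) = f n := by
  refine ⟨fun n => (sub_add_cancel n 1) ▸ f (n - 1), fun n => ?_⟩
  have : ∀ m (h : m + 1 = n + 1), (h ▸ f m : β (n + 1)) = f n := by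
    intro m h
    obtain rfl : m = n := by lia
    rfl
  exact this _ _

/-! ### Morphisms to `r`-injective complexes -/

namespace FilteredComplex

open AbelianElement FilteredObject

variable {A : Type u} [Category.{v} A] [Abelian A] {K L M : CochainComplex (FilteredObject A) ℤ}
  {r : ℕ}

/-- Successive approximation: an element with a small differential can be moved `m` steps down
the filtration by subtracting a boundary. -/
lemma RAcyclic.exists_add (hK : RAcyclic r K) (p n : ℤ) (m : ℕ) {x : El (K.X (n + 1)).obj}
    (hx : x ∈ elements ((K.X (n + 1)).F p))
    (hdx : ev (K.d (n + 1) (n + 1 + 1)).hom x ∈ elements ((K.X (n + 1 + 1)).F (p + m + r))) :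
    ∃ b ∈ elements ((K.X (n + 1)).F (p + m)), ∃ t, x = b + ev (K.d n (n + 1)).hom t := by
  induction m with
  | zero => exact ⟨x, by simpa using hx, 0, by rw [map_zero, add_zero]⟩
  | succ m ih =>
    obtain ⟨b, hb, t, h⟩ := ih (mem_of_le _ (by lia) hdx)
    have hdb : ev (K.d (n + 1) (n + 1 + 1)).hom b = ev (K.d (n + 1) (n + 1 + 1)).hom x := by
      rw [h, map_add, ev_d_d, add_zero]
    obtain ⟨c, hc, s, -, hs⟩ := hK _ n b hb (by
      rw [hdb]
      exact mem_of_le _ (by lia) hdx)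
    exact ⟨c, mem_of_le _ (by lia) hc, s + t, by rw [h, hs, map_add, add_assoc]⟩

/-- In an `r`-acyclic complex the differential is strict, up to the shift by `r`. -/
lemma RAcyclic.exists_eq_add (hK : RAcyclic r K) (p n : ℤ) (x : El (K.X (n + 1)).obj)
    (hdx : ev (K.d (n + 1) (n + 1 + 1)).hom x ∈ elements ((K.X (n + 1 + 1)).F (p + r))) :
    ∃ b ∈ elements ((K.X (n + 1)).F p), ∃ t, x = b + ev (K.d n (n + 1)).hom t := by
  obtain ⟨a, ha⟩ := (K.X (n + 1)).exists_forall_mem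
  rcases le_total a p with h | h
  · have e : a + ((p - a).toNat : ℤ) = p := by lia
    have := hK.exists_add a n (p - a).toNat (ha x)
    rw [e] at this
    exact this hdx
  · exact ⟨x, mem_of_le _ h (ha x), 0, by rw [map_zero, add_zero]⟩

/-- The differential raises the filtration by `r`, that is, `d (F^p) ⊆ F^{p+r}` for all `p`. -/
def RaisesFiltration (r : ℕ) (K : CochainComplex (FilteredObject A) ℤ) : Prop :=
  ∀ n p : ℤ, ∀ x ∈ elements ((K.X n).F p),
    ev (K.d n (n + 1)).hom x ∈ elements ((K.X (n + 1)).F (p + r))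

/-- Every morphism from a bounded below `r`-acyclic complex to an `r`-injective complex is
`r`-homotopic to zero. -/
lemma RAcyclic.exists_rHomotopy (hK : RAcyclic r K) {N : ℤ} (hN : ∀ n ≤ N, IsZero (K.X n))
    (hd : RaisesFiltration r L) (hL : ∀ n p, Injective ((L.X n).gr p)) (u : K ⟶ L) :
    Nonempty (RHomotopy r 0 u) := by
  let β : ℤ → Type _ := fun n => {h : (K.X (n + 1)).obj ⟶ (L.X n).obj //
    ∀ p, ∀ x ∈ elements ((K.X (n + 1)).F (p + r)), ev h x ∈ elements ((L.X n).F p)}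
  let P : ∀ n, β n → β (n + 1) → Prop := fun n a b =>
    a.1 ≫ (L.d n (n + 1)).hom + (K.d (n + 1) (n + 1 + 1)).hom ≫ b.1 = (u.f (n + 1)).hom
  obtain ⟨h, -, hh⟩ := exists_int_sequence (β := β) P (N - 1)
    (fun n => ⟨0, fun _ _ _ => by rw [ev_zero]; exact zero_mem _⟩)
    (fun n hn => hom_ext_ev fun x => by
      rw [eq_zero_of_isZero (hN (n + 1) (by lia)) x, map_zero, map_zero]) (by
    rintro n ⟨a, ha⟩ ⟨b, hb⟩ (hab : a ≫ _ + _ ≫ b = _)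
    have hab' : ∀ t, ev b (ev (K.d (n + 1) (n + 1 + 1)).hom t) = ev (u.f (n + 1)).hom t -
        ev (L.d n (n + 1)).hom (ev a t) := fun t => by
      rw [← hab, ev_add, ev_comp, ev_comp]
      abel
    obtain ⟨c, hc⟩ := exists_filtered_extension (hL (n + 1 + 1))
      (Y := (shiftFiltration (r : ℤ)).obj (K.X (n + 1 + 1 + 1)))
      (K.d (n + 1 + 1) (n + 1 + 1 + 1)).hom
      ((u.f (n + 1 + 1)).hom - b ≫ (L.d (n + 1) (n + 1 + 1)).hom) (by
        intro p x hx
        obtain ⟨y, hy, t, rfl⟩ := hK.exists_eq_add p (n + 1) x hx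
        -- the boundary `d t` is sent to zero, and `F^p` is sent to `F^p`
        have h0 : ev ((u.f (n + 1 + 1)).hom - b ≫ (L.d (n + 1) (n + 1 + 1)).hom)
            (ev (K.d (n + 1) (n + 1 + 1)).hom t) = 0 := by
          rw [ev_sub, ev_comp, hab', map_sub, ev_d_d, sub_zero, ev_d_f, sub_self]
        rw [map_add, h0, add_zero, ev_sub, ev_comp]
        refine sub_mem (Hom.ev_mem _ hy) ?_
        have := hd _ _ _ (hb (p - r) y (by rwa [sub_add_cancel]))
        rwa [sub_add_cancel] at this)
    refine ⟨⟨c.hom, fun p x hx => Hom.ev_mem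
      (X := (shiftFiltration (r : ℤ)).obj (K.X (n + 1 + 1 + 1))) c hx⟩, ?_⟩
    change b ≫ _ + _ ≫ c.hom = _
    have : b ≫ (L.d (n + 1) (n + 1 + 1)).hom + ((u.f (n + 1 + 1)).hom -
      b ≫ (L.d (n + 1) (n + 1 + 1)).hom) = (u.f (n + 1 + 1)).hom := by abel
    rw [← hc] at this
    exact this)
  exact ⟨.ofHom (fun n => (h n).1) (fun n => (h n).2) (fun n => by
    rw [HomologicalComplex.zero_f, zero_hom, sub_zero]
    exact hh n)⟩

lemma _root_.FilteredObject.injective_gr_shiftFiltration {X : FilteredObject A}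
    (hX : ∀ p, Injective (X.gr p)) (s p : ℤ) : Injective (((shiftFiltration s).obj X).gr p) := by
  have h : ∀ q (hq : p + s ≤ q), q = p + s + 1 →
      Injective (cokernel ((X.F q).ofLE (X.F (p + s)) (X.antitone hq))) := by
    rintro q hq rfl
    exact hX _
  exact h (p + 1 + s) (by lia) (by lia)

/-- The complex `L^{n+1}` with the filtration `F(r)` and the opposite differential: the target
of the `r`-homotopies, regarded as morphisms of degree zero. -/
def shiftComplex (r : ℕ) (L : CochainComplex (FilteredObject A) ℤ) :
    CochainComplex (FilteredObject A) ℤ where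
  X n := (shiftFiltration (r : ℤ)).obj (L.X (n + 1))
  d i j := -(shiftFiltration (r : ℤ)).map (L.d (i + 1) (j + 1))
  shape i j h := by
    rw [L.shape _ _ (fun h' : i + 1 + 1 = j + 1 => h (by change i + 1 = j; lia)),
      Functor.map_zero, neg_zero]
  d_comp_d' i j k _ _ := by
    rw [Preadditive.neg_comp_neg, ← Functor.map_comp, L.d_comp_d, Functor.map_zero]

lemma RaisesFiltration.shiftComplex (hd : RaisesFiltration r L) :
    RaisesFiltration r (shiftComplex r L) := by
  intro n p (x : El (L.X (n + 1)).obj) hx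
  have := hd (n + 1) (p + r) x hx
  change ev (-(L.d (n + 1) (n + 1 + 1)).hom) x ∈ elements ((L.X (n + 1 + 1)).F (p + r + r))
  rw [ev_neg]
  exact neg_mem this

/-- The morphism from the `r`-cone of `w : K ⟶ L` given by the projection to `K`. -/
def cone.toShift (w : K ⟶ L) (g : K ⟶ M) : cone r w ⟶ shiftComplex r M where
  f n := homMk (Y := (shiftFiltration (r : ℤ)).obj (M.X (n + 1)))
    (cone.fst r w n ≫ (g.f (n + 1)).hom) fun p x hx => by
      have : ev (cone.fst r w n ≫ (g.f (n + 1)).hom) x ∈ elements ((M.X (n + 1)).F (p + r)) := by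
        rw [ev_comp]
        exact Hom.ev_mem (g.f (n + 1)) (cone.fst_mem r w n hx)
      exact this
  comm' := by
    rintro n _ rfl
    refine hom_ext ?_
    change (cone.fst r w n ≫ (g.f (n + 1)).hom) ≫ (-(M.d (n + 1) (n + 1 + 1)).hom) =
      ((cone r w).d n (n + 1)).hom ≫ cone.fst r w (n + 1) ≫ (g.f (n + 1 + 1)).hom
    rw [← Category.assoc ((cone r w).d n (n + 1)).hom, cone.d_fst, Preadditive.comp_neg,
      Preadditive.neg_comp, Category.assoc, Category.assoc, hom_comm]

section

variable {w : K ⟶ L} (hw : RAcyclic r (cone r w)) {N : ℤ} (hN : ∀ n ≤ N, IsZero ((cone r w).X n))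
  (hd : RaisesFiltration r M) (hM : ∀ n p, Injective ((M.X n).gr p))

include hw hN hd hM

/-- If `w ≫ e` is `r`-homotopic to zero, a homotopy defines an extension of `e` to the cone of
`w`, which is `r`-homotopic to zero because the cone is `r`-acyclic. -/
lemma exists_rHomotopy_of_comp {e : L ⟶ M} (R : RHomotopy r 0 (w ≫ e)) :
    Nonempty (RHomotopy r 0 e) := by
  obtain ⟨H⟩ := hw.exists_rHomotopy hN hd hM (cone.desc e R)
  exact ⟨(H.precomp (CochainComplex.mappingCone.inr (shiftToId r K ≫ w))).congr
    (by rw [cone.inr_desc, comp_zero])⟩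

/-- A morphism `g` extends along `w` up to `r`-homotopy. The projection from the cone of `w` to
`K`, followed by `g`, is null-homotopic; the components of the null-homotopy on the two summands
of the cone are an extension `e` and an `r`-homotopy from `g` to `w ≫ e`. -/
lemma exists_lift_up_to_rHomotopy (g : K ⟶ M) :
    ∃ e : L ⟶ M, Nonempty (RHomotopy r g (w ≫ e)) := by
  obtain ⟨H⟩ := hw.exists_rHomotopy hN hd.shiftComplex
    (fun n p => injective_gr_shiftFiltration (hM (n + 1)) r p) (cone.toShift w g)
  -- the null-homotopy, with its target regarded as an object of the abelian category
  let H' : ∀ n, ((cone r w).X (n + 1)).obj ⟶ (M.X (n + 1)).obj := fun n => H.hom n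
  have hmem : ∀ n p, ∀ x ∈ elements (((cone r w).X (n + 1)).F p),
      ev (H' n) x ∈ elements ((M.X (n + 1)).F p) := by
    intro n p x hx
    have : ev (H' n) x ∈ elements ((M.X (n + 1)).F (p - r + r)) :=
      H.ev_mem n (p := p - r) (sub_add_cancel p (r : ℤ)) hx
    rwa [sub_add_cancel] at this
  have hcomm : ∀ n, H' n ≫ (-(M.d (n + 1) (n + 1 + 1)).hom) +
      ((cone r w).d (n + 1) (n + 1 + 1)).hom ≫ H' (n + 1) =
        cone.fst r w (n + 1) ≫ (g.f (n + 1 + 1)).hom := by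
    intro n
    refine (H.comm_hom n).trans ?_
    rw [HomologicalComplex.zero_f, zero_hom, sub_zero]
    rfl
  obtain ⟨e, he⟩ := exists_of_succ (β := fun n => L.X n ⟶ M.X n) (fun n =>
    homMk (cone.inr r w (n + 1) ≫ H' n) fun p x hx => by
      rw [ev_comp]
      exact hmem n p _ (cone.inr_mem r w _ hx))
  obtain ⟨k, hk⟩ := exists_of_succ
    (β := fun n => {h : (K.X (n + 1)).obj ⟶ (M.X n).obj //
      ∀ p, ∀ x ∈ elements ((K.X (n + 1)).F (p + r)), ev h x ∈ elements ((M.X n).F p)})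
    (fun n => ⟨cone.inl r w (n + 1) ≫ H' n, fun p x hx => by
      rw [ev_comp]
      exact hmem n p _ (cone.inl_mem r w _ hx)⟩)
  have he' : ∀ n, (e (n + 1)).hom = cone.inr r w (n + 1) ≫ H' n := fun n => by rw [he, homMk_hom]
  refine ⟨⟨e, ?_⟩, ⟨.ofHom (fun n => (k n).1) (fun n => (k n).2) fun n => ?_⟩⟩
  · rintro i _ rfl
    obtain ⟨n, rfl⟩ : ∃ n, i = n + 1 := ⟨i - 1, by lia⟩
    refine hom_ext ?_
    rw [comp_hom, comp_hom, he', he']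
    have h := congr_arg (cone.inr r w (n + 1) ≫ ·) (hcomm n)
    rw [Preadditive.comp_add, Preadditive.comp_neg, Preadditive.comp_neg, ← Category.assoc,
      ← Category.assoc, ← Category.assoc, cone.inr_fst, cone.inr_d, zero_comp,
      neg_add_eq_zero, Category.assoc (L.d _ _).hom] at h
    exact h
  · obtain ⟨n, rfl⟩ : ∃ m, n = m + 1 := ⟨n - 1, by lia⟩
    have h := congr_arg (cone.inl r w (n + 1) ≫ ·) (hcomm n)
    rw [Preadditive.comp_add, Preadditive.comp_neg, Preadditive.comp_neg, ← Category.assoc,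
      ← Category.assoc, ← Category.assoc, cone.inl_fst, cone.inl_d, Category.id_comp,
      Preadditive.sub_comp, Category.assoc (w.f _).hom, ← he', Category.assoc (K.d _ _).hom] at h
    rw [hk, hk, HomologicalComplex.comp_f, comp_hom, ← h]
    abel

end

end FilteredComplex

/-! ### Filtered injective resolutions -/

namespace FilteredObject

open AbelianElement

variable {A : Type u} [Category.{v} A] [Abelian A]

/-- A graded piece is injective if it is a retract of an injective object; the retraction is
described on representatives in `X`. -/
lemma injective_gr_of_retract {X : FilteredObject A} {J : A} [Injective J] (p : ℤ)
    (π : X.obj ⟶ J) (ι : J ⟶ X.obj) (h1 : ∀ x ∈ elements (X.F (p + 1)), ev π x = 0)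
    (h2 : ∀ y, ev ι y ∈ elements (X.F p))
    (h3 : ∀ x ∈ elements (X.F p), ev ι (ev π x) - x ∈ elements (X.F (p + 1))) :
    Injective (X.gr p) := by
  have h1' : (X.F (p + 1)).ofLE (X.F p) (X.antitone (by lia)) ≫ (X.F p).arrow ≫ π = 0 := by
    rw [← Category.assoc, Subobject.ofLE_arrow]
    refine hom_ext_ev fun x => ?_
    rw [ev_comp, ev_zero]
    exact h1 _ (ev_arrow_mem _ x)
  have h2' : (X.F p).Factors ι := (factors_iff _ _).2 h2
  obtain ⟨i, hi⟩ : ∃ i : X.gr p ⟶ J, X.toGr p ≫ i = (X.F p).arrow ≫ π :=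
    ⟨cokernel.desc _ _ h1', cokernel.π_desc _ _ _⟩
  let r : Retract (X.gr p) J :=
    { i := i
      r := Subobject.factorThru _ _ h2' ≫ X.toGr p
      retract := by
        have : Epi (X.toGr p) := coequalizer.π_epi
        rw [← cancel_epi (X.toGr p), ← Category.assoc, hi, Category.comp_id]
        refine hom_ext_ev fun x => ?_
        rw [← sub_eq_zero, ev_comp, ev_comp, ev_comp, ← map_sub, toGr_eq_zero_iff, map_sub,
          ← ev_comp _ (X.F p).arrow, Subobject.factorThru_arrow]
        exact h3 _ (ev_arrow_mem _ x) }
  exact r.injective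

attribute [local instance] Abelian.hasFiniteBiproducts

section

variable (s : Finset ℤ) (J : ℤ → A)

/-- The idempotent of `⨁ J` which projects to the sum of the `J q` with `q < p`. -/
def gradedSumProj (p : ℤ) : (⨁ fun q : s => J q) ⟶ ⨁ fun q : s => J q :=
  ∑ q : s with q.1 < p, biproduct.π (fun q : s => J q) q ≫ biproduct.ι (fun q : s => J q) q

variable {s J} in
lemma el_biproduct_ext {x y : El (⨁ fun q : s => J q)}
    (h : ∀ q : s, ev (biproduct.π (fun q : s => J q) q) x =
      ev (biproduct.π (fun q : s => J q) q) y) : x = y := by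
  have ht := biproduct.total (f := fun q : s => J q)
  have (x : El (⨁ fun q : s => J q)) := congr_arg (fun f => ev f x) ht
  simp only [ev_sum, ev_comp, ev_id] at this
  rw [← this x, ← this y]
  exact Finset.sum_congr rfl fun q _ => by rw [h q]

variable {s J} in
lemma ev_gradedSumProj_eq_zero_iff (p : ℤ) (x : El (⨁ fun q : s => J q)) :
    ev (gradedSumProj s J p) x = 0 ↔
      ∀ q : s, q.1 < p → ev (biproduct.π (fun q : s => J q) q) x = 0 := by
  rw [gradedSumProj, ev_sum]
  constructor
  · intro h q hq
    have h' := congr_arg (ev (biproduct.π (fun q : s => J q) q)) h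
    rw [map_sum, map_zero, Finset.sum_eq_single q] at h'
    · rwa [← ev_comp, Category.assoc, biproduct.ι_π_self, Category.comp_id] at h'
    · intro q' _ hne
      rw [← ev_comp, Category.assoc, biproduct.ι_π_ne _ hne, comp_zero, ev_zero]
    · intro hq'
      exact absurd (Finset.mem_filter.2 ⟨Finset.mem_univ q, hq⟩) hq'
  · intro h
    refine Finset.sum_eq_zero fun q hq => ?_
    rw [ev_comp, h q (Finset.mem_filter.1 hq).2, map_zero]

/-- The direct sum of the objects `J q`, for `q` in a finite set of integers, where `J q` is
placed in filtration degree `q`. -/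
def gradedSum : FilteredObject A where
  obj := ⨁ fun q : s => J q
  F p := kernelSubobject (gradedSumProj s J p)
  antitone p q h := by
    rw [le_iff]
    intro x hx
    rw [mem_kernelSubobject, ev_gradedSumProj_eq_zero_iff] at hx ⊢
    exact fun i hi => hx i (by lia)
  exists_eq_top := by
    obtain ⟨a, ha⟩ := s.bddBelow
    refine ⟨a, eq_top_iff_elements.2 fun x => ?_⟩
    rw [mem_kernelSubobject, ev_gradedSumProj_eq_zero_iff]
    exact fun q hq => absurd (ha q.2) (by lia)
  exists_eq_bot := by
    obtain ⟨b, hb⟩ := s.bddAbove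
    refine ⟨b + 1, eq_bot_iff_elements.2 fun x hx => ?_⟩
    rw [mem_kernelSubobject, ev_gradedSumProj_eq_zero_iff] at hx
    refine el_biproduct_ext fun q => ?_
    rw [map_zero]
    exact hx q (by have := hb q.2; lia)

variable {s J} in
lemma mem_gradedSum_iff (p : ℤ) (x : El (⨁ fun q : s => J q)) :
    x ∈ elements ((gradedSum s J).F p) ↔
      ∀ q : s, q.1 < p → ev (biproduct.π (fun q : s => J q) q) x = 0 := by
  change x ∈ elements (kernelSubobject _) ↔ _
  rw [mem_kernelSubobject, ev_gradedSumProj_eq_zero_iff]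

lemma injective_gr_gradedSum (hJ : ∀ q, Injective (J q)) (p : ℤ) :
    Injective ((gradedSum s J).gr p) := by
  by_cases hp : p ∈ s
  · have h1 : ∀ (y : El (J p)) (q : s), q.1 < p → ev (biproduct.π (fun q : s => J q) q)
        (ev (biproduct.ι (fun q : s => J q) ⟨p, hp⟩) y) = 0 := fun y q hq => by
      rw [← ev_comp, biproduct.ι_π_ne _ (by rintro rfl; simp at hq), ev_zero]
    have h2 : ∀ x : El (⨁ fun q : s => J q),
        (∀ q : s, q.1 < p → ev (biproduct.π (fun q : s => J q) q) x = 0) →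
        ∀ q : s, q.1 < p + 1 → ev (biproduct.π (fun q : s => J q) q)
          (ev (biproduct.ι (fun q : s => J q) ⟨p, hp⟩)
            (ev (biproduct.π (fun q : s => J q) ⟨p, hp⟩) x) - x) = 0 := fun x hx q hq => by
      rw [map_sub, ← ev_comp (biproduct.ι (fun q : s => J q) _)]
      rcases eq_or_ne q ⟨p, hp⟩ with rfl | hne
      · rw [biproduct.ι_π_self, ev_id, sub_self]
      · rw [biproduct.ι_π_ne _ hne.symm, ev_zero, zero_sub, neg_eq_zero]
        have : q.1 ≠ p := fun h => hne (Subtype.ext h)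
        exact hx q (by lia)
    exact injective_gr_of_retract (X := gradedSum s J) (J := J p) p
      (biproduct.π (fun q : s => J q) ⟨p, hp⟩) (biproduct.ι (fun q : s => J q) ⟨p, hp⟩)
      (fun x hx => (mem_gradedSum_iff (p + 1) x).1 hx ⟨p, hp⟩ (by dsimp; lia))
      (fun y => (mem_gradedSum_iff p _).2 (h1 y))
      (fun x hx => (mem_gradedSum_iff (p + 1) _).2 (h2 x ((mem_gradedSum_iff p x).1 hx)))
  · refine injective_gr_of_retract (X := gradedSum s J) (J := J p) p 0 0
      (fun _ _ => ev_zero _) (fun y => by rw [ev_zero]; exact zero_mem _) (fun x hx => ?_)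
    rw [ev_zero, zero_sub]
    refine neg_mem ((mem_gradedSum_iff (p + 1) x).2 fun q hq => ?_)
    have : q.1 ≠ p := fun h => hp (h ▸ q.2)
    exact (mem_gradedSum_iff p x).1 hx q (by lia)

end

/-- A filtered object with a subobject `U` maps to an object with injective graded pieces, by a
morphism with kernel `U` such that the induced morphism on the quotient by `U` is strict. -/
lemma exists_strict_hom [EnoughInjectives A] (Q : FilteredObject A) (U : Subobject Q.obj) :
    ∃ (I : FilteredObject A) (v : Q ⟶ I), (∀ p, Injective (I.gr p)) ∧
      (∀ x ∈ elements U, ev v.hom x = 0) ∧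
      ∀ p x, ev v.hom x ∈ elements (I.F p) → x ∈ elements (Q.F p ⊔ U) := by
  obtain ⟨a, ha⟩ := Q.exists_forall_mem
  obtain ⟨b, hb⟩ := Q.exists_eq_zero_of_mem
  -- the component of `v` of degree `q` has kernel `F^{q+1} Q + U`
  let J : ℤ → A := fun q => Injective.under (cokernel (Q.F (q + 1) ⊔ U).arrow)
  let s := Finset.Icc a (max a b)
  let v : Q.obj ⟶ ⨁ fun q : s => J q := biproduct.lift fun q : s =>
    cokernel.π (Q.F (q.1 + 1) ⊔ U).arrow ≫ Injective.ι _
  have hv : ∀ (q : s) x, ev (biproduct.π (fun q : s => J q) q) (ev v x) = 0 ↔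
      x ∈ elements (Q.F (q.1 + 1) ⊔ U) := by
    intro q x
    rw [← ev_comp, biproduct.lift_π, ev_comp, mem_iff_cokernel]
    exact map_eq_zero_iff _ (ev_injective _)
  refine ⟨gradedSum s J, homMk (Y := gradedSum s J) v fun p x hx => ?_,
    injective_gr_gradedSum s J fun q => inferInstance, fun x hx => ?_, fun p x hx => ?_⟩
  · exact (mem_gradedSum_iff p _).2 fun q hq =>
      (hv q x).2 (elements_mono le_sup_left (mem_of_le Q (by lia) hx))
  · exact el_biproduct_ext fun q =>
      ((hv q x).2 (elements_mono le_sup_right hx)).trans (map_zero _).symm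
  · rcases le_or_gt p a with hpa | hpa
    · exact elements_mono le_sup_left (mem_of_le Q hpa (ha x))
    · have hq : min (p - 1) (max a b) ∈ s := by
        rw [Finset.mem_Icc]
        lia
      have h := (hv ⟨_, hq⟩ x).1 ((mem_gradedSum_iff p _).1 hx ⟨_, hq⟩ (by dsimp; lia))
      dsimp only at h
      rcases le_or_gt (p - 1) (max a b) with h' | h'
      · rwa [min_eq_left h', sub_add_cancel] at h
      · rw [min_eq_right h'.le, mem_sup] at h
        obtain ⟨c, hc, d, hd, rfl⟩ := h
        rw [hb c (mem_of_le Q (by lia) hc), zero_add]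
        exact elements_mono le_sup_right hd

end FilteredObject

namespace FilteredComplex

open AbelianElement FilteredObject

variable {A : Type u} [Category.{v} A] [Abelian A]

/-- The part in degree `n` of a morphism from `K` to an injective complex under construction:
an injective filtered object `I`, the morphism `ρ : K^n ⟶ I`, and the subobject `U` of
`I ⊕ K^{n+1}` of the boundaries of the cone of `ρ`. -/
structure ResolutionStage (K : CochainComplex (FilteredObject A) ℤ) (n : ℤ) where
  /-- the term of the injective complex -/
  I : FilteredObject A
  injective_gr : ∀ p, Injective (I.gr p)
  /-- the augmentation -/
  ρ : K.X n ⟶ I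
  /-- the boundaries of the cone -/
  U : Subobject (I.obj ⊞ (K.X (n + 1)).obj)

namespace ResolutionStage

/-- The conditions on a differential `δ` between consecutive stages: it raises the filtration
by `r`, it vanishes (together with `ρ`) on the boundaries, the resulting differential of the cone
is strict up to the shift by `r`, and the next boundaries are its image. -/
structure IsDifferential (r : ℕ) {K : CochainComplex (FilteredObject A) ℤ} {n : ℤ}
    (a : ResolutionStage K n) (b : ResolutionStage K (n + 1)) (δ : a.I.obj ⟶ b.I.obj) : Prop where
  mem : ∀ p, ∀ x ∈ elements (a.I.F p), ev δ x ∈ elements (b.I.F (p + r))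
  eq_zero : ∀ z ∈ elements a.U, ev δ (ev biprod.fst z) + ev b.ρ.hom (ev biprod.snd z) = 0
  strict : ∀ p x y, ev δ x + ev b.ρ.hom y ∈ elements (b.I.F (p + r)) →
    ∃ z ∈ elements a.U, x - ev biprod.fst z ∈ elements (a.I.F p) ∧
      y - ev biprod.snd z ∈ elements ((K.X (n + 1)).F (p + r))
  mem_iff : ∀ z, z ∈ elements b.U ↔ ∃ x y, ev biprod.fst z = ev δ x + ev b.ρ.hom y ∧
    ev biprod.snd z = -ev (K.d (n + 1) (n + 1 + 1)).hom y

variable {K : CochainComplex (FilteredObject A) ℤ}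

lemma el_biprod_ext {X Y : A} {z z' : El (X ⊞ Y)} (h : ev biprod.fst z = ev biprod.fst z')
    (h' : ev biprod.snd z = ev biprod.snd z') : z = z' := by
  have ht (z : El (X ⊞ Y)) := congr_arg (fun f => ev f z) (biprod.total (X := X) (Y := Y))
  simp only [ev_add, ev_comp, ev_id] at ht
  rw [← ht z, ← ht z', h, h']

lemma exists_el_biprod {X Y : A} (x : El X) (y : El Y) :
    ∃ z : El (X ⊞ Y), ev biprod.fst z = x ∧ ev biprod.snd z = y := by
  refine ⟨ev biprod.inl x + ev biprod.inr y, ?_, ?_⟩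
  · rw [map_add, ← ev_comp, ← ev_comp, biprod.inl_fst, biprod.inr_fst, ev_id, ev_zero, add_zero]
  · rw [map_add, ← ev_comp, ← ev_comp, biprod.inl_snd, biprod.inr_snd, ev_id, ev_zero, zero_add]

/-- The next stage is obtained by mapping the quotient of `I ⊕ K^{n+1}` by the boundaries,
with `K^{n+1}` filtered by `F(r)`, strictly to an injective object. -/
lemma exists_isDifferential [EnoughInjectives A] (r : ℕ) {n : ℤ} (a : ResolutionStage K n) :
    ∃ (b : ResolutionStage K (n + 1)) (δ : a.I.obj ⟶ b.I.obj), IsDifferential r a b δ := by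
  obtain ⟨I, w, hI, hU, hv⟩ := exists_strict_hom
    (a.I.prod ((shiftFiltration (r : ℤ)).obj (K.X (n + 1)))) a.U
  -- the morphism `w`, with the underlying object of the direct sum made explicit
  obtain ⟨v, hU, hv, hδ, hρ⟩ : ∃ v : a.I.obj ⊞ (K.X (n + 1)).obj ⟶ I.obj,
      (∀ z ∈ elements a.U, ev v z = 0) ∧
      (∀ p x, ev v x ∈ elements (I.F p) → ∃ z ∈ elements a.U,
        ev biprod.fst (x - z) ∈ elements (a.I.F p) ∧
          ev biprod.snd (x - z) ∈ elements ((K.X (n + 1)).F (p + r))) ∧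
      (∀ p, ∀ x ∈ elements (a.I.F p), ev v (ev biprod.inl x) ∈ elements (I.F p)) ∧
      ∀ p, ∀ y ∈ elements ((K.X (n + 1)).F (p + r)),
        ev v (ev biprod.inr y) ∈ elements (I.F p) := by
    refine ⟨w.hom, hU, fun p x hx => ?_,
      fun p x hx => w.ev_mem (prod_inl_mem a.I ((shiftFiltration (r : ℤ)).obj _) p x hx),
      fun p y hy => w.ev_mem (prod_inr_mem a.I ((shiftFiltration (r : ℤ)).obj _) p y hy)⟩
    obtain ⟨(c : El (a.I.obj ⊞ (K.X (n + 1)).obj)), hc,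
      (z : El (a.I.obj ⊞ (K.X (n + 1)).obj)), hz, h⟩ := (mem_sup _ _ _).1 (hv p x hx)
    obtain rfl : x - z = c := sub_eq_of_eq_add h.symm
    exact ⟨z, hz, (mem_prod_iff _ _ _ _).1 hc⟩
  have hvz : ∀ z, ev v z = ev (biprod.inl ≫ v) (ev biprod.fst z) +
      ev (biprod.inr ≫ v) (ev biprod.snd z) := fun z => by
    have : biprod.fst ≫ biprod.inl ≫ v + biprod.snd ≫ biprod.inr ≫ v = v := by
      rw [← Category.assoc, ← Category.assoc, ← Preadditive.add_comp, biprod.total,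
        Category.id_comp]
    rw [← ev_comp, ← ev_comp, ← ev_add, this]
  simp only [← ev_comp] at hδ hρ
  generalize biprod.inl ≫ v = δ at hvz hδ
  generalize biprod.inr ≫ v = ρ at hvz hρ
  -- the filtration of the next term is shifted, so that `δ` raises it by `r`
  have hF : ∀ p, I.F p = ((shiftFiltration (-r : ℤ)).obj I).F (p + r) := fun p => by
    change I.F p = I.F (p + r + -r)
    rw [add_neg_cancel_right]
  refine ⟨⟨(shiftFiltration (-r : ℤ)).obj I, injective_gr_shiftFiltration hI _,
    homMk (Y := (shiftFiltration (-r : ℤ)).obj I) ρ fun p y hy => ?_,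
    imageSubobject (biprod.lift (biprod.desc δ ρ)
      (-(biprod.snd ≫ (K.d (n + 1) (n + 1 + 1)).hom)))⟩, δ, ⟨?_, ?_, ?_, ?_⟩⟩
  · exact hρ (p + -r) y (by rwa [neg_add_cancel_right])
  · intro p x hx
    rw [← hF]
    exact hδ p x hx
  · intro z hz
    exact (hvz z).symm.trans (hU z hz)
  · intro p x y hxy
    obtain ⟨w, rfl, rfl⟩ := exists_el_biprod x y
    rw [← hF] at hxy
    obtain ⟨z, hz, h⟩ := hv p w (by rw [hvz]; exact hxy)
    rw [map_sub, map_sub] at h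
    exact ⟨z, hz, h⟩
  · intro z
    change z ∈ elements (imageSubobject _) ↔ _
    rw [mem_imageSubobject]
    have h1 : ∀ w, ev biprod.fst (ev (biprod.lift (biprod.desc δ ρ)
        (-(biprod.snd ≫ (K.d (n + 1) (n + 1 + 1)).hom))) w) =
          ev δ (ev biprod.fst w) + ev ρ (ev biprod.snd w) := fun w => by
      rw [← ev_comp, biprod.lift_fst, biprod.desc_eq, ev_add, ev_comp, ev_comp]
    have h2 : ∀ w, ev biprod.snd (ev (biprod.lift (biprod.desc δ ρ)
        (-(biprod.snd ≫ (K.d (n + 1) (n + 1 + 1)).hom))) w) =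
          -ev (K.d (n + 1) (n + 1 + 1)).hom (ev biprod.snd w) := fun w => by
      rw [← ev_comp, biprod.lift_snd, ev_neg, ev_comp]
    constructor
    · rintro ⟨w, rfl⟩
      exact ⟨_, _, h1 w, h2 w⟩
    · rintro ⟨x, y, hx, hy⟩
      obtain ⟨w, rfl, rfl⟩ := exists_el_biprod x y
      exact ⟨w, el_biprod_ext ((h1 w).trans hx.symm) ((h2 w).trans hy.symm)⟩

/-- The zero stage. -/
def zero (K : CochainComplex (FilteredObject A) ℤ) (n : ℤ) : ResolutionStage K n where
  I := FilteredObject.zero A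
  injective_gr p := by
    have hz : IsZero (FilteredObject.zero A).obj := isZero_zero A
    have h0 : ∀ x : El ((FilteredObject.zero A).F p : A), x = 0 := fun x =>
      ev_injective ((FilteredObject.zero A).F p).arrow
        ((el_eq_zero_of_isZero hz _).trans (map_zero _).symm)
    have : Epi ((FilteredObject.zero A).toGr p) := coequalizer.π_epi
    apply IsZero.injective
    rw [IsZero.iff_id_eq_zero, ← cancel_epi ((FilteredObject.zero A).toGr p)]
    refine hom_ext_ev fun x => ?_
    rw [h0 x, map_zero, map_zero]
  ρ := 0
  U := ⊥

lemma isDifferential_zero (r : ℕ) {n : ℤ} (h : IsZero (K.X (n + 1))) {a : ResolutionStage K n}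
    {b : ResolutionStage K (n + 1)} (ha : ∀ x : El a.I.obj, x = 0)
    (hb : ∀ x : El b.I.obj, x = 0) (hU : ∀ z ∈ elements b.U, z = 0) :
    IsDifferential r a b 0 where
  mem p x _ := by
    rw [ev_zero]
    exact zero_mem _
  eq_zero z _ := hb _
  strict p x y _ := by
    refine ⟨0, zero_mem _, ?_, ?_⟩
    · rw [ha (_ - _)]
      exact zero_mem _
    · rw [eq_zero_of_isZero h (_ - _)]
      exact zero_mem _
  mem_iff z := by
    constructor
    · intro hz
      exact ⟨0, 0, (hb _).trans (hb _).symm, by rw [hU z hz, map_zero, map_zero, neg_zero]⟩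
    · rintro ⟨x, y, -, hy⟩
      have : z = 0 := el_biprod_ext ((hb _).trans (hb _).symm)
        (by rw [hy, eq_zero_of_isZero h y, map_zero, map_zero, neg_zero])
      rw [this]
      exact zero_mem _

end ResolutionStage

open ResolutionStage in
/-- Every bounded below complex has a morphism `ρ` to an `r`-injective complex, such that the
cone of `ρ` is exact and its differential strict, up to the shift by `r`. -/
lemma exists_strict_resolution [EnoughInjectives A] (r : ℕ)
    (K : CochainComplex (FilteredObject A) ℤ) (N : ℤ) (hN : ∀ n ≤ N, IsZero (K.X n)) :
    ∃ (I : CochainComplex (FilteredObject A) ℤ) (ρ : K ⟶ I),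
      (∀ n p, Injective ((I.X n).gr p)) ∧ RaisesFiltration r I ∧ (∀ n ≤ N - 1, IsZero (I.X n)) ∧
      ∀ n p x y, ev (I.d (n + 1) (n + 1 + 1)).hom x + ev (ρ.f (n + 1 + 1)).hom y ∈
          elements ((I.X (n + 1 + 1)).F (p + r)) →
        ∃ x' y', x - (ev (I.d n (n + 1)).hom x' + ev (ρ.f (n + 1)).hom y') ∈
            elements ((I.X (n + 1)).F p) ∧
          y + ev (K.d (n + 1) (n + 1 + 1)).hom y' ∈ elements ((K.X (n + 1 + 1)).F (p + r)) := by
  obtain ⟨s, hs₀, hs⟩ := exists_int_sequence (β := ResolutionStage K)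
    (fun n a b => ∃ δ, IsDifferential r a b δ) (N - 1) (zero K)
    (fun n hn => ⟨_, isDifferential_zero r (hN _ (by lia))
      (el_eq_zero_of_isZero (isZero_zero A)) (el_eq_zero_of_isZero (isZero_zero A))
      (fun z hz => (mem_bot z).1 hz)⟩)
    (fun n _ b _ => exists_isDifferential r b)
  choose δ hδ using hs
  have hmem : ∀ n x y, ∃ z ∈ elements (s (n + 1)).U,
      ev biprod.fst z = ev (δ n) x + ev (s (n + 1)).ρ.hom y ∧
        ev biprod.snd z = -ev (K.d (n + 1) (n + 1 + 1)).hom y := fun n x y => by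
    obtain ⟨z, hz, hz'⟩ := exists_el_biprod (ev (δ n) x + ev (s (n + 1)).ρ.hom y)
      (-ev (K.d (n + 1) (n + 1 + 1)).hom y)
    exact ⟨z, ((hδ n).mem_iff z).2 ⟨x, y, hz, hz'⟩, hz, hz'⟩
  let d : ∀ n, (s n).I ⟶ (s (n + 1)).I := fun n => homMk (δ n) fun p x hx =>
    mem_of_le _ (by lia) ((hδ n).mem p x hx)
  let I : CochainComplex (FilteredObject A) ℤ := CochainComplex.of (fun n => (s n).I) d fun n => by
    refine hom_ext (hom_ext_ev fun x => ?_)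
    obtain ⟨z, hz, h, h'⟩ := hmem n x 0
    have := (hδ (n + 1)).eq_zero z hz
    rw [h, h', map_zero, map_zero, neg_zero, map_zero, add_zero, add_zero] at this
    rw [comp_hom, ev_comp, zero_hom, ev_zero]
    exact this
  have hd : ∀ n, (I.d n (n + 1)).hom = δ n := fun n => by
    exact congr_arg Hom.hom (CochainComplex.of_d (fun n => (s n).I) d n)
  let ρ : K ⟶ I :=
    { f := fun n => (s n).ρ
      comm' := by
        rintro i _ rfl
        obtain ⟨n, rfl⟩ : ∃ n, i = n + 1 := ⟨i - 1, by lia⟩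
        refine hom_ext (hom_ext_ev fun y => ?_)
        obtain ⟨z, hz, h, h'⟩ := hmem n 0 y
        have := (hδ (n + 1)).eq_zero z hz
        rw [h, h', map_zero, zero_add, map_neg, add_neg_eq_zero] at this
        rw [comp_hom, comp_hom, hd, ev_comp, ev_comp]
        exact this }
  refine ⟨I, ρ, fun n => (s n).injective_gr, fun n p x hx => ?_, fun n hn => ?_,
    fun n p x y hxy => ?_⟩
  · rw [hd]
    exact (hδ n).mem p x hx
  · have : (s n).I = FilteredObject.zero A := by rw [hs₀ n hn]; rfl
    change IsZero (s n).I
    rw [this, FilteredObject.isZero_iff]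
    exact el_eq_zero_of_isZero (isZero_zero A)
  · rw [hd] at hxy
    obtain ⟨z, hz, h, h'⟩ := (hδ (n + 1)).strict p x y hxy
    obtain ⟨x', y', e, e'⟩ := ((hδ n).mem_iff z).1 hz
    rw [e] at h
    rw [e', sub_neg_eq_add] at h'
    refine ⟨x', y', ?_, h'⟩
    rw [hd]
    exact h

/-- A morphism whose cone is exact, with a differential that is strict up to the shift by `r`,
is an `E_r`-quasi-isomorphism. -/
lemma page_quasiIso_of_strict {r : ℕ} {K I : CochainComplex (FilteredObject A) ℤ} (ρ : K ⟶ I)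
    (h : ∀ n p x y, ev (I.d (n + 1) (n + 1 + 1)).hom x + ev (ρ.f (n + 1 + 1)).hom y ∈
        elements ((I.X (n + 1 + 1)).F (p + r)) →
      ∃ x' y', x - (ev (I.d n (n + 1)).hom x' + ev (ρ.f (n + 1)).hom y') ∈
          elements ((I.X (n + 1)).F p) ∧
        y + ev (K.d (n + 1) (n + 1 + 1)).hom y' ∈ elements ((K.X (n + 1 + 1)).F (p + r))) :
    QuasiIso ((page r).map ρ) := by
  rw [page_quasiIso_iff]
  -- in both cases, strictness is applied first to the given element of the cone, which becomes a
  -- boundary of `(x₁, y₁)` modulo terms of high filtration, and then to `(x₁, y₁)`, in order to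
  -- replace it by an element of controlled filtration with the same boundary
  constructor
  · rintro p i _ _ rfl rfl x hx - b hb t ht hxb
    obtain ⟨m, rfl⟩ : ∃ m, i = m + 1 + 1 := ⟨i - 2, by lia⟩
    obtain ⟨x₁, y₁, h₁, h₁'⟩ := h (m + 1) (p + 1 - r) (-t) x (by
      rw [hxb, map_neg, sub_add_cancel]
      convert hb using 1
      abel)
    rw [sub_add_cancel] at h₁'
    obtain ⟨-, y₂, -, h₂⟩ := h m (p - r - r) x₁ y₁ (by
      rw [sub_add_cancel]
      have := sub_mem (neg_mem ht) (mem_of_le _ (by lia) h₁)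
      rwa [sub_sub_cancel] at this)
    rw [sub_add_cancel] at h₂
    refine ⟨_, h₁', _, neg_mem h₂, ?_⟩
    rw [map_neg, map_add, ev_d_d, add_zero, add_neg_cancel_right]
  · rintro p i _ _ rfl rfl y hy hdy
    obtain ⟨m, rfl⟩ : ∃ m, i = m + 1 := ⟨i - 1, by lia⟩
    obtain ⟨x₁, y₁, h₁, h₁'⟩ := h (m + 1) (p + 1) y 0 (by
      rw [map_zero, add_zero]
      exact mem_of_le _ (by lia) hdy)
    rw [zero_add] at h₁'
    obtain ⟨x₂, y₂, h₂, h₂'⟩ := h m (p - r) x₁ y₁ (by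
      rw [sub_add_cancel]
      have := sub_mem hy (mem_of_le _ (by lia) h₁)
      rwa [sub_sub_cancel] at this)
    rw [sub_add_cancel] at h₂'
    refine ⟨_, h₂', ?_, _, h₁, _, h₂, ?_⟩
    · rw [map_add, ev_d_d, add_zero]
      exact mem_of_le _ (by lia) h₁'
    · rw [map_sub, map_add, map_add, ev_d_d, zero_add, ev_d_f]
      abel

lemma exists_isZero (K : CochainComplex.Plus (FilteredObject A)) :
    ∃ N : ℤ, ∀ n ≤ N, IsZero (K.obj.X n) := by
  obtain ⟨N, hN⟩ := K.property
  exact ⟨N - 1, fun n hn => K.obj.isZero_of_isStrictlyGE N n (by lia)⟩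

/-- A complex which vanishes in small degrees, as a bounded below complex. -/
def plusMk (K : CochainComplex (FilteredObject A) ℤ) (h : ∃ N : ℤ, ∀ n ≤ N, IsZero (K.X n)) :
    CochainComplex.Plus (FilteredObject A) :=
  ⟨K, by
    obtain ⟨N, hN⟩ := h
    exact ⟨N, (K.isStrictlyGE_iff N).2 fun n hn => hN n hn.le⟩⟩

/-- Every bounded below filtered complex has an `r`-injective resolution. -/
lemma exists_rInjective_resolution [EnoughInjectives A] (r : ℕ)
    (K : CochainComplex.Plus (FilteredObject A)) :
    ∃ (I : CochainComplex.Plus (FilteredObject A)) (ρ : K ⟶ I),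
      rInjective A r I ∧ rQuasiIsomorphisms A r ρ := by
  obtain ⟨N, hN⟩ := exists_isZero K
  obtain ⟨I, ρ, hI, hd, hz, h⟩ := exists_strict_resolution r K.obj N hN
  exact ⟨plusMk I ⟨_, hz⟩, ObjectProperty.homMk ρ,
    ⟨fun p n => (factors_arrow_iff _).2 (hd n p), fun p n => hI n p⟩, page_quasiIso_of_strict ρ h⟩

/-! ### Localization at the strong and the weak equivalences -/

section

variable {r : ℕ} {M : CochainComplex.Plus (FilteredObject A)}

lemma exists_isZero_cone {K L : CochainComplex.Plus (FilteredObject A)} (w : K ⟶ L) :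
    ∃ N : ℤ, ∀ n ≤ N, IsZero ((cone r w.hom).X n) := by
  obtain ⟨a, ha⟩ := exists_isZero K
  obtain ⟨b, hb⟩ := exists_isZero L
  exact ⟨min (a - 1) b, fun n hn => cone.isZero_X n (ha _ (by lia)) (hb _ (by lia))⟩

/-- An `r`-injective complex is local for the `E_r`-quasi-isomorphisms, up to `r`-homotopy. -/
lemma isLocalUpTo_rQuasiIsomorphisms (hM : rInjective A r M) :
    CartanEilenberg.IsLocalUpTo (rHomotopic A r) (rQuasiIsomorphisms A r) M := by
  have hd : RaisesFiltration r M.obj := fun n p => (factors_arrow_iff _).1 (hM.1 p n)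
  constructor
  · intro X Y w hw a
    obtain ⟨N, hN⟩ := exists_isZero_cone (r := r) w
    obtain ⟨e, ⟨R⟩⟩ := exists_lift_up_to_rHomotopy (rAcyclic_cone hw) hN hd
      (fun n p => hM.2 p n) a.hom
    exact ⟨ObjectProperty.homMk e, ⟨R.symm⟩⟩
  · rintro X Y w hw b b' ⟨R⟩
    obtain ⟨N, hN⟩ := exists_isZero_cone (r := r) w
    obtain ⟨R'⟩ := exists_rHomotopy_of_comp (rAcyclic_cone hw) hN hd (fun n p => hM.2 p n)
      (e := b'.hom - b.hom) (R.congr (by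
        rw [Preadditive.comp_sub, sub_zero]
        rfl))
    exact ⟨R'.congr (sub_zero _)⟩

/-- Every complex is local for the `r`-homotopy equivalences, up to `r`-homotopy. -/
lemma isLocalUpTo_rHomotopyEquivalences (M : CochainComplex.Plus (FilteredObject A)) :
    CartanEilenberg.IsLocalUpTo (rHomotopic A r) (rHomotopyEquivalences A r) M := by
  constructor
  · rintro X Y w ⟨v, ⟨R⟩, -⟩ a
    exact ⟨v ≫ a, ⟨(R.postcomp a.hom).congr (by simp)⟩⟩
  · rintro X Y w ⟨v, -, ⟨R⟩⟩ b b' ⟨H⟩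
    exact ⟨((R.postcomp b.hom).symm.congr
      (f' := b.hom) (g' := v.hom ≫ w.hom ≫ b.hom) (by simp)).trans
      ((H.precomp v.hom).trans ((R.postcomp b'.hom).congr (by simp)))⟩

end

section

variable {K L : CochainComplex (FilteredObject A) ℤ} (r : ℕ)

/-- The `r`-cone of an identity is `r`-contractible. -/
def cone.contraction (K : CochainComplex (FilteredObject A) ℤ) :
    RHomotopy r 0 (𝟙 (cone r (𝟙 K))) :=
  .ofHom (fun n => cone.snd r (𝟙 K) (n + 1) ≫ cone.inl r (𝟙 K) n)
    (fun n p x hx => by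
      rw [ev_comp]
      exact cone.inl_mem r _ n (cone.snd_mem r _ _ hx))
    (fun n => by
      refine hom_ext_ev fun x => cone.ext_ev _ _ _ ?_ ?_
      · simp [cone.ev_d_fst, cone.ev_d_snd]
      · simp [cone.ev_d_snd])

variable {r}

/-- Homotopic morphisms become equal once the `r`-homotopy equivalences are inverted: they are
restrictions of a morphism from `K ⊕ C`, where `C` is the `r`-cone of the identity of `K`,
along two sections of the projection to `K`. -/
lemma map_eq_of_rHomotopic {D : Type*} [Category* D]
    {G : CochainComplex.Plus (FilteredObject A) ⥤ D}
    (hG : (rHomotopyEquivalences A r).IsInvertedBy G)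
    {K L : CochainComplex.Plus (FilteredObject A)} (f g : K ⟶ L) (h : rHomotopic A r f g) :
    G.map f = G.map g := by
  obtain ⟨R⟩ := h
  let C := cone r (𝟙 K.obj)
  let j : K.obj ⟶ C := CochainComplex.mappingCone.inr (shiftToId r K.obj ≫ 𝟙 K.obj)
  let Cyl : CochainComplex.Plus (FilteredObject A) := plusMk (K.obj ⊞ C) (by
    obtain ⟨a, ha⟩ := exists_isZero K
    obtain ⟨b, hb⟩ := exists_isZero_cone (r := r) (𝟙 K)
    refine ⟨min a b, fun n hn => ?_⟩
    rw [IsZero.iff_id_eq_zero, ← HomologicalComplex.id_f, ← biprod.total,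
      HomologicalComplex.add_f_apply, HomologicalComplex.comp_f, HomologicalComplex.comp_f,
      (ha n (by lia)).eq_of_tgt ((biprod.fst : K.obj ⊞ C ⟶ K.obj).f n) 0,
      (hb n (by lia)).eq_of_tgt ((biprod.snd : K.obj ⊞ C ⟶ C).f n) 0,
      zero_comp, zero_comp, add_zero])
  let π : Cyl ⟶ K := ObjectProperty.homMk biprod.fst
  let s₀ : K ⟶ Cyl := ObjectProperty.homMk biprod.inl
  let s₁ : K ⟶ Cyl := ObjectProperty.homMk (biprod.lift (𝟙 K.obj) j)
  let e : C ⟶ L.obj := cone.desc (g.hom - f.hom) (R.congr (by rw [Category.id_comp, sub_zero]))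
  have he : j ≫ e = g.hom - f.hom := cone.inr_desc _ _
  let H : Cyl ⟶ L := ObjectProperty.homMk (biprod.desc f.hom e)
  have hs₀ : s₀ ≫ π = 𝟙 K := ObjectProperty.hom_ext _ biprod.inl_fst
  have hs₁ : s₁ ≫ π = 𝟙 K := ObjectProperty.hom_ext _ (biprod.lift_fst _ _)
  have hf : s₀ ≫ H = f := ObjectProperty.hom_ext _ (biprod.inl_desc _ _)
  have hg : s₁ ≫ H = g := ObjectProperty.hom_ext _ (by
    change biprod.lift (𝟙 K.obj) j ≫ biprod.desc f.hom e = g.hom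
    rw [biprod.lift_desc, Category.id_comp, he, add_sub_cancel])
  have hπ : rHomotopyEquivalences A r π := by
    refine ⟨s₀, ⟨(((cone.contraction r K.obj).precomp biprod.snd).postcomp
      biprod.inr).congr ?_⟩, ?_⟩
    · change _ = 𝟙 (K.obj ⊞ C) - biprod.fst ≫ biprod.inl
      rw [← biprod.total, add_sub_cancel_left, Category.comp_id, comp_zero, zero_comp, sub_zero]
    · rw [hs₀]
      exact ⟨.refl _⟩
  have : IsIso (G.map π) := hG π hπ
  have hs : G.map s₀ = G.map s₁ := by
    rw [← cancel_mono (G.map π), ← G.map_comp, ← G.map_comp, hs₀, hs₁]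
  rw [← hf, ← hg, G.map_comp, G.map_comp, hs]

end

open CartanEilenberg

variable (r : ℕ)

lemma map_eq_strong {K L : CochainComplex.Plus (FilteredObject A)} (f g : K ⟶ L)
    (h : rHomotopic A r f g) :
    (rHomotopyEquivalences A r).Q.map f = (rHomotopyEquivalences A r).Q.map g :=
  map_eq_of_rHomotopic (rHomotopyEquivalences A r).Q_inverts f g h

lemma map_eq_weak {K L : CochainComplex.Plus (FilteredObject A)} (f g : K ⟶ L)
    (h : rHomotopic A r f g) :
    (rQuasiIsomorphisms A r).Q.map f = (rQuasiIsomorphisms A r).Q.map g :=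
  map_eq_of_rHomotopic (fun _ _ w hw => (rQuasiIsomorphisms A r).Q_inverts w
    ((isCategoryWithStrongAndWeakEquivalences r).strong_le_weak w hw)) f g h

variable {r} in
lemma isFibrant_of_rInjective {M : CochainComplex.Plus (FilteredObject A)}
    (hM : rInjective A r M) :
    IsFibrant (rHomotopyEquivalences A r) (rQuasiIsomorphisms A r) M := by
  intro X Y w hw
  have hS := isLocalUpTo_rHomotopyEquivalences (r := r) M
  have hW := isLocalUpTo_rQuasiIsomorphisms hM
  have hQ {X Y : CochainComplex.Plus (FilteredObject A)} := map_eq_strong r (K := X) (L := Y)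
  constructor
  · intro a b hab
    obtain ⟨a, rfl⟩ := hS.exists_map_eq (fun _ _ => hQ) a
    obtain ⟨b, rfl⟩ := hS.exists_map_eq (fun _ _ => hQ) b
    dsimp only at hab
    rw [← Functor.map_comp, ← Functor.map_comp] at hab
    exact hQ _ _ (hW.injective w hw _ _ (hS.rel_of_map_eq _ _ hab))
  · intro a
    obtain ⟨a, rfl⟩ := hS.exists_map_eq (fun _ _ => hQ) a
    obtain ⟨b, hb⟩ := hW.exists_lift w hw a
    refine ⟨(rHomotopyEquivalences A r).Q.map b, ?_⟩
    dsimp only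
    rw [← Functor.map_comp]
    exact hQ _ _ hb

lemma isRightCartanEilenbergWithModels [EnoughInjectives A] :
    IsRightCartanEilenbergWithModels
      (rHomotopyEquivalences A r) (rQuasiIsomorphisms A r) (rInjective A r) where
  toStrongWeak := isCategoryWithStrongAndWeakEquivalences r
  isFibrant _ := isFibrant_of_rInjective
  exists_model K := by
    obtain ⟨I, ρ, hI, hρ⟩ := exists_rInjective_resolution r K
    refine ⟨I, hI, (rHomotopyEquivalences A r).Q.map ρ, ?_⟩
    exact (rQuasiIsomorphisms A r).Q_inverts ρ hρ

/-- The functor from the `r`-homotopy category of `r`-injective complexes to the `r`-derived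
category which is induced by the inclusion. -/
def toRDerivedCategory : RInjectiveHomotopyCategory A r ⥤ RDerivedCategory A r :=
  CategoryTheory.Quotient.lift _ ((rInjective A r).ι ⋙ (rQuasiIsomorphisms A r).Q)
    fun _ _ f g h => map_eq_weak r f.hom g.hom h

instance : (toRDerivedCategory (A := A) r).Faithful where
  map_injective {X Y} f g h := by
    obtain ⟨f, rfl⟩ := (CategoryTheory.Quotient.functor _).map_surjective f
    obtain ⟨g, rfl⟩ := (CategoryTheory.Quotient.functor _).map_surjective g
    exact CategoryTheory.Quotient.sound _
      ((isLocalUpTo_rQuasiIsomorphisms Y.as.property).rel_of_map_eq f.hom g.hom h)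

instance : (toRDerivedCategory (A := A) r).Full where
  map_surjective {X Y} φ := by
    obtain ⟨f, hf⟩ := (isLocalUpTo_rQuasiIsomorphisms Y.as.property).exists_map_eq
      (fun _ _ => map_eq_weak r) φ
    exact ⟨(CategoryTheory.Quotient.functor _).map (ObjectProperty.homMk f), hf⟩

instance [EnoughInjectives A] : (toRDerivedCategory (A := A) r).EssSurj where
  mem_essImage Y := by
    obtain ⟨K, rfl⟩ := (Localization.Construction.objEquiv _).surjective Y
    obtain ⟨I, ρ, hI, hρ⟩ := exists_rInjective_resolution r K
    exact ⟨(CategoryTheory.Quotient.functor _).obj ⟨I, hI⟩,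
      ⟨(Localization.Construction.wIso ρ hρ).symm⟩⟩

end FilteredComplex

end

open FilteredComplex CartanEilenberg in
theorem mainTheorem6 (A : Type u) [Category.{v} A] [Abelian A] [EnoughInjectives A] (r : ℕ) :
    IsRightCartanEilenbergWithModels
        (rHomotopyEquivalences A r) (rQuasiIsomorphisms A r) (rInjective A r) ∧
      (∀ K : CochainComplex.Plus (FilteredObject A),
        ∃ (I : CochainComplex.Plus (FilteredObject A)) (ρ : K ⟶ I),
          rInjective A r I ∧ rQuasiIsomorphisms A r ρ) ∧
      ∃ Φ : RInjectiveHomotopyCategory A r ⥤ RDerivedCategory A r,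
        Quotient.functor (rInjectiveHomotopic A r) ⋙ Φ =
            (rInjective A r).ι ⋙ (rQuasiIsomorphisms A r).Q ∧
          Φ.IsEquivalence :=
  ⟨isRightCartanEilenbergWithModels r, exists_rInjective_resolution r,
    toRDerivedCategory r, Quotient.lift_spec _ _ _, { }⟩
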